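/- Let $X$ be a compact (connected) Riemann surface of genus $g\ge 2$, given with a marked Schottky uniformization: an isomorphism $\rho$ of the free group $F_g$ on $g$ letters onto a Schottky group $\Gamma\subset \mathrm{PGL}(2,\mathbb C)$ of rank $g$ with limit set $\Lambda\subset\mathbf P^1(\mathbb C)$, such that $X\cong\Gamma\backslash(\mathbf P^1(\mathbb C)-\Lambda)$ as Riemann surfaces. Let $x_0\in\mathbf P^1(\mathbb C)-\Lambda$. For $w\in F_g$ let $\overrightarrow w\subset\Lambda$ be the set of all limits $\lim_n\rho(v_n)(x_0)$, where $v_n$ consists of the first $n$ letters of an infinite reduced word that begins with the reduced word $w$. Let $\mu$ be the Patterson–Sullivan measure of $\Gamma$, i.e. the Borel probability measure on $\Lambda$ with $\mu(\gamma E)=\int_E|\gamma'|^{\delta}\,d\mu$ for all $\gamma\in\Gamma$ and all Borel sets $E\subset\Lambda$, where $\delta$ is the Hausdorff dimension of $\Lambda$ and $\delta$ and $|\gamma'|$ are taken with respect to the round metric of the sphere. Let $A=C(\Lambda)$ be the C*-algebra of continuous complex functions on $\Lambda$, let $H$ be the Hilbert space of the GNS representation of $A$ for the state $\tau(f)=\int_\Lambda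 f\,d\mu$, let $A_n\subset A$ be the span of the characteristic functions of the sets $\overrightarrow w$ with $w$ of length $\le n$, let $P_n$ be the orthogonal projection of $H$ onto the image $H_n$ of $A_n$, and let $$D=\lambda_0P_0+\sum_{n\ge1}\lambda_n(P_n-P_{n-1}),\qquad \lambda_n=(\dim A_n)^3,$$ with domain the set of all vectors of $H$ for which the series converges. Then the sets $\overrightarrow w$ are open and closed in $\Lambda$, the union $A_\infty$ of the $A_n$ is the algebra of locally constant functions on $\Lambda$, and $\mathcal S_X=(A,H,D)$ is a 1-summable spectral triple, that is: 1. $D$ is self-adjoint, and $(D-z)^{-1}$ exists and is a compact operator for every $z\in\mathbb C\setminus\mathbb R$; 2. $A_\infty$ is a dense involutive subalgebra of $A$, and every $a\in A_\infty$, acting on $H$ by the GNS representation, preserves the domain of $D$ and has a bounded commutator $[D,a]$; 3. $\operatorname{tr}\big((1+D^2)^{-1/2}\big)<\infty$. -/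

import Mathlib

open scoped MatrixGroups Topology Manifold ContDiff InnerProductSpace
open MeasureTheory Filter

noncomputable section

/-! ## Möbius transformations of the Riemann sphere, Schottky groups and limit sets -/

namespace Schottky

/-- The Riemann sphere `ℙ¹(ℂ) = ℂ ∪ {∞}`. -/
abbrev Sphere : Type := OnePoint ℂ

/-- Scalar matrices act trivially on the sphere. -/
theorem scalar_smul_sphere (u : ℂˣ) (x : OnePoint ℂ) :
    Matrix.GeneralLinearGroup.scalar (Fin 2) u • x = x := by
  have hu : (u : ℂ) ≠ 0 := u.ne_zero
  induction x using OnePoint.rec with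
  | infty => simp [OnePoint.smul_infty_eq_ite]
  | coe z => simp [OnePoint.smul_some_eq_ite, hu]

/-- `PGL(2, ℂ)` acts on the sphere by Möbius transformations. -/
instance moebiusAction : MulAction PGL(2, ℂ) (OnePoint ℂ) :=
  Matrix.ProjGenLinGroup.mulActionOfGL scalar_smul_sphere

theorem mk_smul_sphere (A : GL (Fin 2) ℂ) (x : OnePoint ℂ) :
    (Matrix.ProjGenLinGroup.mk A : PGL(2, ℂ)) • x = A • x := rfl

instance sphereMeasurableSpace : MeasurableSpace (OnePoint ℂ) := borel _

instance sphereBorelSpace : BorelSpace (OnePoint ℂ) := ⟨rfl⟩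

/-- `Γ` is a Schottky group of rank `g`: there are `2g` pairwise disjoint closed topological discs
`D₁, D₁', …, D_g, D_g'` in the sphere (`D i false` and `D i true`; their boundaries are the
usual Jordan curves) and Möbius transformations `γ₁, …, γ_g` generating `Γ` such that `γᵢ` maps the
exterior of `Dᵢ` onto the interior of `Dᵢ'`. -/
def IsSchottkyGroup (g : ℕ) (Γ : Subgroup PGL(2, ℂ)) : Prop :=
  ∃ (γ : Fin g → PGL(2, ℂ)) (D : Fin g × Bool → Set Sphere),
    (∀ i, Nonempty (D i ≃ₜ Metric.closedBall (0 : ℂ) 1)) ∧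
    (Pairwise fun i j => Disjoint (D i) (D j)) ∧
    (∀ i, (fun x => γ i • x) '' (D (i, false))ᶜ = interior (D (i, true))) ∧
    Γ = Subgroup.closure (Set.range γ)

/-- The limit set `Λ` of `Γ`: the closure of the set of accumulation points of orbits of `Γ`,
i.e. of points `x = lim γₙ z` with `z` in the sphere and the `γₙ` distinct elements of `Γ`.
(For discrete groups such as Schottky groups the accumulation points already form a closed set.) -/
def limitSet (Γ : Subgroup PGL(2, ℂ)) : Set Sphere :=
  closure {x | ∃ z : Sphere, ∃ γ : ℕ → Γ, Function.Injective γ ∧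
    Tendsto (fun n => (γ n : PGL(2, ℂ)) • z) atTop (𝓝 x)}

instance limitSetCompact (Γ : Subgroup PGL(2, ℂ)) : CompactSpace (limitSet Γ) :=
  isCompact_iff_compactSpace.mp isClosed_closure.isCompact

/-! ## Compact Riemann surfaces and Schottky uniformization -/

/-- The connected surface `X` has genus `g`: its first homology group, that is, the
abelianization of its fundamental group, has rank `2g`. -/
def HasGenus (X : Type*) [TopologicalSpace X] (g : ℕ) : Prop :=
  ∀ x : X, Module.finrank ℤ (Additive (Abelianization (FundamentalGroup X x))) = 2 * g

/-- A (marked) Schottky uniformization of the Riemann surface `X`: `ρ` is an isomorphism of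
the free group of rank `g` onto a Schottky group `Γ` of rank `g`, and `X = Γ \ (ℙ¹(ℂ) - Λ)` as a
Riemann surface, that is, there is a holomorphic map from `ℙ¹(ℂ) - Λ` onto `X` whose fibres are the
orbits of `Γ` (holomorphy is tested in all affine charts `z ↦ A • z` of the sphere; the values
of `p` on `Λ` are irrelevant). -/
structure IsSchottkyUniformization (X : Type*) [TopologicalSpace X] [ChartedSpace ℂ X] {g : ℕ}
    (ρ : FreeGroup (Fin g) →* PGL(2, ℂ)) : Prop where
  injective : Function.Injective ρ
  isSchottkyGroup : IsSchottkyGroup g ρ.range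
  quotient : ∃ p : Sphere → X,
    Set.SurjOn p (limitSet ρ.range)ᶜ Set.univ ∧
    (∀ x ∈ (limitSet ρ.range)ᶜ, ∀ y ∈ (limitSet ρ.range)ᶜ,
      p x = p y ↔ ∃ γ ∈ ρ.range, γ • x = y) ∧
    ∀ A : GL (Fin 2) ℂ, MDifferentiableOn 𝓘(ℂ) 𝓘(ℂ) (fun z : ℂ => p (A • (z : Sphere)))
      {z : ℂ | A • (z : Sphere) ∈ (limitSet ρ.range)ᶜ}

/-! ## The Patterson–Sullivan measure -/

/-- The standard embedding of the Riemann sphere as the unit sphere in `ℂ × ℝ`. -/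
def toUnitSphere : Sphere → ℂ × ℝ
  | none => (0, 1)
  | some z => ((2 * z) / (1 + ‖z‖ ^ 2 : ℝ), (‖z‖ ^ 2 - 1) / (‖z‖ ^ 2 + 1))

/-- The Hausdorff dimension of the limit set for the round metric of the sphere (the metric of
`ℂ × ℝ` is bi-Lipschitz to the Euclidean one, so both give the same dimension). -/
def limitDim (Γ : Subgroup PGL(2, ℂ)) : ℝ := (dimH (toUnitSphere '' limitSet Γ)).toReal

/-- `|γ'(x)|` for the Möbius transformation `γ` given by the matrix `A`, with respect to the round
metric of the sphere; it depends on `A` only up to scalars. -/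
def derivNorm (A : GL (Fin 2) ℂ) : Sphere → ℝ
  | none => ‖(A : Matrix (Fin 2) (Fin 2) ℂ).det‖ / (‖A 0 0‖ ^ 2 + ‖A 1 0‖ ^ 2)
  | some z => ‖(A : Matrix (Fin 2) (Fin 2) ℂ).det‖ * (‖z‖ ^ 2 + 1) /
      (‖A 0 0 * z + A 0 1‖ ^ 2 + ‖A 1 0 * z + A 1 1‖ ^ 2)

/-- The probability measure `μ` on the limit set is the Patterson–Sullivan measure: it scales by
`γ^* dμ = |γ'|^δ dμ`, i.e. `μ(γ E) = ∫_E |γ'|^δ dμ`, for all `γ` in `Γ`, with `δ` the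
Hausdorff dimension of the limit set. -/
def IsPattersonSullivan (Γ : Subgroup PGL(2, ℂ)) (μ : Measure (limitSet Γ))
    [IsProbabilityMeasure μ] : Prop :=
  ∀ A : GL (Fin 2) ℂ, Matrix.ProjGenLinGroup.mk A ∈ Γ →
    ∀ E : Set (limitSet Γ), MeasurableSet E →
      μ {x | ∃ y ∈ E, A • (y : Sphere) = (x : Sphere)} =
        ∫⁻ x in E, ENNReal.ofReal (derivNorm A (x : Sphere) ^ limitDim Γ) ∂μ

/-! ## The state `τ` and its GNS representation -/

section State

open scoped ComplexOrder

variable {Γ : Subgroup PGL(2, ℂ)} (μ : Measure (limitSet Γ)) [IsProbabilityMeasure μ]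

theorem integrable_continuousMap (f : C(limitSet Γ, ℂ)) : Integrable (fun x => f x) μ :=
  f.continuous.integrable_of_hasCompactSupport (HasCompactSupport.of_compactSpace _)

/-- The state `τ(f) = ∫ f dμ` on the C*-algebra `A = C(Λ)`. -/
def state : C(limitSet Γ, ℂ) →ₚ[ℂ] ℂ :=
  PositiveLinearMap.mk₀
    { toFun := fun f => ∫ x, f x ∂μ
      map_add' := fun f h => by
        simpa using integral_add (integrable_continuousMap μ f) (integrable_continuousMap μ h)
      map_smul' := fun c f => by
        simpa using integral_const_mul c (fun x => f x) }
    (fun f hf => integral_nonneg (fun x => hf x))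

/-- The Hilbert space `H`: the completion of `A = C(Λ)` for `⟨a, b⟩ = τ(a^* b)`. -/
abbrev HilbertSpace : Type := (state μ).GNS

/-- The GNS representation of `A = C(Λ)` on `H`, by multiplication. -/
def rep : C(limitSet Γ, ℂ) →⋆ₐ[ℂ] (HilbertSpace μ →L[ℂ] HilbertSpace μ) :=
  (state μ).gnsStarAlgHom

/-- The canonical map `A → H`. -/
def toHilbertSpace : C(limitSet Γ, ℂ) →ₗ[ℂ] HilbertSpace μ :=
  (UniformSpace.Completion.toComplL (𝕜 := ℂ) (E := (state μ).PreGNS)).toLinearMap ∘ₗ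
    (state μ).toPreGNS.toLinearMap

end State

/-! ## Ends of words and the filtration -/

section Filtration

variable {g : ℕ}

/-- Infinite reduced words in the generators and their inverses (the letter `(i, true)` is the
`i`-th generator, `(i, false)` its inverse), i.e. the points of the boundary of the Cayley graph of
the free group. -/
def IsInfiniteReducedWord (ξ : ℕ → Fin g × Bool) : Prop :=
  ∀ n, (ξ n).1 = (ξ (n + 1)).1 → (ξ n).2 = (ξ (n + 1)).2

/-- The word formed by the first `n` letters of `ξ`. -/
def initialWord (ξ : ℕ → Fin g × Bool) (n : ℕ) : FreeGroup (Fin g) :=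
  FreeGroup.mk (List.ofFn fun i : Fin n => ξ i)

variable (ρ : FreeGroup (Fin g) →* PGL(2, ℂ)) (x₀ : Sphere)

/-- The set of ends of the word `w`: the points `lim ρ(vₙ) x₀` of the limit set, with `vₙ` the
initial words of an infinite reduced word starting with `w`. -/
def ends (w : FreeGroup (Fin g)) : Set (limitSet ρ.range) :=
  {x | ∃ ξ : ℕ → Fin g × Bool, IsInfiniteReducedWord ξ ∧ initialWord ξ w.norm = w ∧
    Tendsto (fun n => ρ (initialWord ξ n) • x₀) atTop (𝓝 (x : Sphere))}

/-- `A_n`: the span of the characteristic functions of the sets of ends of words of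
length at most `n`. -/
def filtration (n : ℕ) : Submodule ℂ C(limitSet ρ.range, ℂ) :=
  Submodule.span ℂ {f | ∃ w : FreeGroup (Fin g), w.norm ≤ n ∧
    (f : limitSet ρ.range → ℂ) = (ends ρ x₀ w).indicator 1}

instance filtration_finiteDimensional (n : ℕ) : FiniteDimensional ℂ (filtration ρ x₀ n) := by
  apply FiniteDimensional.span_of_finite
  have h1 : {w : FreeGroup (Fin g) | w.norm ≤ n}.Finite :=
    ((List.finite_length_le (Fin g × Bool) n).preimage
      (FreeGroup.toWord_injective.injOn)).subset (fun w hw => hw)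
  refine (h1.image (fun w => (ends ρ x₀ w).indicator (1 : limitSet ρ.range → ℂ))).preimage
    (f := fun f : C(limitSet ρ.range, ℂ) => (f : limitSet ρ.range → ℂ))
    (DFunLike.coe_injective.injOn) |>.subset ?_
  rintro f ⟨w, hw, hf⟩
  exact ⟨w, hw, hf.symm⟩

variable (μ : Measure (limitSet ρ.range)) [IsProbabilityMeasure μ]

/-- `H_n`: the (finite-dimensional) subspace of `H` corresponding to `A_n`. -/
def hilbertFiltration (n : ℕ) : Submodule ℂ (HilbertSpace μ) :=
  (filtration ρ x₀ n).map (toHilbertSpace μ)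

instance hilbertFiltration_finiteDimensional (n : ℕ) :
    FiniteDimensional ℂ (hilbertFiltration ρ x₀ μ n) := by
  unfold hilbertFiltration; infer_instance

/-- `P_n`: the orthogonal projection of `H` onto `H_n`. -/
def proj (n : ℕ) : HilbertSpace μ →L[ℂ] HilbertSpace μ :=
  (hilbertFiltration ρ x₀ μ n).starProjection

/-- `Q_0 = P_0` and `Q_n = P_n - P_{n-1}` for `n ≥ 1`. -/
def gradedProj : ℕ → (HilbertSpace μ →L[ℂ] HilbertSpace μ)
  | 0 => proj ρ x₀ μ 0
  | n + 1 => proj ρ x₀ μ (n + 1) - proj ρ x₀ μ n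

/-- `λ_n = (dim A_n)^3`. -/
def diracEigenvalue (n : ℕ) : ℂ := (Module.finrank ℂ (filtration ρ x₀ n) : ℂ) ^ 3

/-- The Dirac operator `D = λ_0 P_0 + ∑_{n ≥ 1} λ_n (P_n - P_{n-1})`, defined on the set of all
vectors for which the series converges (its terms are mutually orthogonal, so that
convergence and unconditional convergence are the same). -/
def dirac : HilbertSpace μ →ₗ.[ℂ] HilbertSpace μ where
  domain :=
    { carrier := {x | Summable fun n => diracEigenvalue ρ x₀ n • gradedProj ρ x₀ μ n x}
      zero_mem' := by simp [summable_zero]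
      add_mem' := fun {x y} hx hy => by simpa using hx.add hy
      smul_mem' := fun c x hx => by
        simpa [smul_comm c] using hx.const_smul c }
  toFun :=
    { toFun := fun x => ∑' n, diracEigenvalue ρ x₀ n • gradedProj ρ x₀ μ n x
      map_add' := fun x y => by simpa using x.2.tsum_add y.2
      map_smul' := fun c x => by
        simpa [smul_comm c] using x.2.tsum_const_smul c }

end Filtration

/-! ## Spectral triples -/

/-- The involutive subalgebra of locally constant functions in `C(Y)`. -/
def locallyConstant (Y : Type*) [TopologicalSpace Y] : StarSubalgebra ℂ C(Y, ℂ) where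
  carrier := {f | IsLocallyConstant f}
  mul_mem' := fun {a b} ha hb => IsLocallyConstant.mul (f := a) (g := b) ha hb
  add_mem' := fun {a b} ha hb => IsLocallyConstant.add (f := a) (g := b) ha hb
  algebraMap_mem' := fun r => IsLocallyConstant.const r
  star_mem' := fun {a} ha => IsLocallyConstant.comp (f := a) ha star

section SpectralTriple

universe u

variable {H : Type*} [NormedAddCommGroup H] [InnerProductSpace ℂ H] [CompleteSpace H]

/-- For every non-real `z`, the unbounded operator `D - z` has a compact (everywhere defined)
inverse. -/
def HasCompactResolvent (D : H →ₗ.[ℂ] H) : Prop :=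
  ∀ z : ℂ, z.im ≠ 0 → ∃ R : H →L[ℂ] H, IsCompactOperator R ∧
    (∀ y, ∃ hy : R y ∈ D.domain, D ⟨R y, hy⟩ - z • R y = y) ∧
    ∀ x : D.domain, R (D x - z • (x : H)) = x

/-- The bounded operator `T` preserves the domain of `D`, and the commutator `[D, T]` is
bounded on this domain. -/
def HasBoundedCommutator (D : H →ₗ.[ℂ] H) (T : H →L[ℂ] H) : Prop :=
  ∃ hT : ∀ x ∈ D.domain, T x ∈ D.domain, ∃ C : ℝ, ∀ x : D.domain,
    ‖D ⟨T x, hT x x.2⟩ - T (D x)‖ ≤ C * ‖(x : H)‖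

/-- `(A, H, D)`, with `A` acting on `H` by `π`, is a spectral triple, with dense involutive
subalgebra `A'`. -/
structure IsSpectralTriple {A : Type*} [CStarAlgebra A] (π : A →⋆ₐ[ℂ] (H →L[ℂ] H))
    (D : H →ₗ.[ℂ] H) (A' : StarSubalgebra ℂ A) : Prop where
  isSelfAdjoint : IsSelfAdjoint D
  hasCompactResolvent : HasCompactResolvent D
  dense : Dense (A' : Set A)
  hasBoundedCommutator : ∀ a ∈ A', HasBoundedCommutator D (π a)

/-- For self-adjoint `D`: `T = (1 + D²)^{-1/2}`, i.e. `T` is the positive bounded operator with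
`(1 + D²) T² = 1`. -/
def IsInvSqrtOneAddSq (D : H →ₗ.[ℂ] H) (T : H →L[ℂ] H) : Prop :=
  T.IsPositive ∧ ∀ y : H, ∃ (h₁ : T (T y) ∈ D.domain) (h₂ : D ⟨T (T y), h₁⟩ ∈ D.domain),
    T (T y) + D ⟨D ⟨T (T y), h₁⟩, h₂⟩ = y

/-- The positive operator `T` has finite trace: `∑ ⟨e, T e⟩ < ∞` for all
orthonormal bases. -/
def HasFiniteTrace {H : Type u} [NormedAddCommGroup H] [InnerProductSpace ℂ H] (T : H →L[ℂ] H) :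
    Prop :=
  ∀ (ι : Type u) (b : HilbertBasis ι ℂ H), Summable fun i => (⟪b i, T (b i)⟫_ℂ).re

/-- `D` is 1-summable: `tr ((1 + D²)^{-1/2}) < ∞`. -/
def IsOneSummable (D : H →ₗ.[ℂ] H) : Prop :=
  ∃ T : H →L[ℂ] H, IsInvSqrtOneAddSq D T ∧ HasFiniteTrace T

end SpectralTriple

end Schottky

end

/-! The argument has a geometric half and a Hilbert space half.

Geometry: sending an infinite reduced word to the limit of `ρ(vₙ) x₀` is a homeomorphism from the
boundary of the free group onto `Λ` (`IsPingPong.isBoundaryCoding`,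
`IsBoundaryCoding.exists_homeomorph`). The Schottky discs are in ping-pong position, so reduced
words label nested closed sets. A family of Möbius transformations, rescaled as matrices, has a
nonzero limit along an ultrafilter (`convergence_dichotomy`). An invertible limit is impossible for
infinitely many group elements, because the translates of the exterior of the discs are disjoint. A
limit of rank one contracts everything away from a repelling point to an attracting point. Hence the
nested sets along an infinite word shrink to a point (`IsPingPong.eq_of_mem_nest_initialList`). The
marking `ρ` may differ from the one given by the discs by an automorphism of the free group, but an
automorphism is uniformly continuous on prefixes (`exists_wordPrefix_map_eq`), so it acts on
infinite words.

Under this coding the sets of ends are cylinders, and `A_n` is the algebra of functions of the first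
`n` letters (`IsBoundaryCoding.mem_filtration_iff`). Compactness gives `⋃ A_n` = locally constant
functions, and branching of words gives `dim A_n ≥ n + 1`.

Hilbert space: `D` is diagonal for the mutually orthogonal projections `P_n - P_{n-1}`, which sum
strongly to 1 because `⋃ A_n` is dense. For `a` in `A_m` and `n ≥ m`, both `a` and `a*` preserve
`H_n`, so `a` commutes with `P_n` and only finitely many terms of `[D, a]` survive
(`hasBoundedCommutator_diagonal`). With `d = dim A_n`, the `n`-th eigenspace contributes at most `d
(1 + d⁶)^(-1/2) ≤ d⁻² ≤ (n + 1)⁻²` to the trace. -/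

namespace Schottky

/-! ### Diagonal operators for an orthogonal grading of a Hilbert space. -/

section Grading

variable {H : Type*} [NormedAddCommGroup H] [InnerProductSpace ℂ H]

/-- An orthogonal decomposition of the Hilbert space `H` into a sequence of finite-dimensional
subspaces, given by the orthogonal projections onto them. -/
structure IsOrthogonalGrading (Q : ℕ → H →L[ℂ] H) : Prop where
  inner_left : ∀ n x y, ⟪Q n x, y⟫_ℂ = ⟪x, Q n y⟫_ℂ
  idem : ∀ n x, Q n (Q n x) = Q n x
  orth : ∀ m n, m ≠ n → ∀ x, Q m (Q n x) = 0
  hasSum : ∀ x, HasSum (fun n => Q n x) x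
  compact : ∀ n, IsCompactOperator (Q n)

/-- The operator `∑ l n • Q n` on the set of all vectors for which the series converges. -/
noncomputable def diagonal (Q : ℕ → H →L[ℂ] H) (l : ℕ → ℂ) : H →ₗ.[ℂ] H where
  domain :=
    { carrier := {x | Summable fun n => l n • Q n x}
      zero_mem' := by simp [summable_zero]
      add_mem' := fun {x y} hx hy => by simpa using hx.add hy
      smul_mem' := fun c x hx => by simpa [smul_comm c] using hx.const_smul c }
  toFun :=
    { toFun := fun x => ∑' n, l n • Q n x
      map_add' := fun x y => by simpa using x.2.tsum_add y.2
      map_smul' := fun c x => by simpa [smul_comm c] using x.2.tsum_const_smul c }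

variable {Q : ℕ → H →L[ℂ] H} {l c : ℕ → ℂ}

theorem mem_diagonal_domain {x : H} :
    x ∈ (diagonal Q l).domain ↔ Summable fun n => l n • Q n x := Iff.rfl

theorem diagonal_apply (x : (diagonal Q l).domain) :
    diagonal Q l x = ∑' n, l n • Q n x := rfl

theorem hasSum_diagonal (x : (diagonal Q l).domain) :
    HasSum (fun n => l n • Q n x) (diagonal Q l x) :=
  (mem_diagonal_domain.1 x.2).hasSum

theorem IsOrthogonalGrading.norm_le_one (hQ : IsOrthogonalGrading Q) (n : ℕ) : ‖Q n‖ ≤ 1 := by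
  refine ContinuousLinearMap.opNorm_le_bound _ zero_le_one fun x => ?_
  rw [one_mul]
  by_cases h : ‖Q n x‖ = 0
  · rw [h]; positivity
  have h1 : ‖Q n x‖ * ‖Q n x‖ ≤ ‖x‖ * ‖Q n x‖ := by
    calc ‖Q n x‖ * ‖Q n x‖ = ‖⟪Q n x, Q n x⟫_ℂ‖ := by
          rw [inner_self_eq_norm_sq_to_K]; simp [sq]
      _ = ‖⟪x, Q n x⟫_ℂ‖ := by rw [hQ.inner_left, hQ.idem]
      _ ≤ _ := norm_inner_le_norm _ _
  exact le_of_mul_le_mul_right h1 (lt_of_le_of_ne (norm_nonneg _) (Ne.symm h))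

theorem IsOrthogonalGrading.apply_of_hasSum (hQ : IsOrthogonalGrading Q) {x y : H}
    (h : HasSum (fun n => l n • Q n x) y) (m : ℕ) : Q m y = l m • Q m x := by
  have h1 := h.mapL (Q m)
  refine h1.unique ?_
  convert hasSum_single m ?_ using 1
  · simp [hQ.idem]
  · intro n hn
    simp [hQ.orth m n hn.symm]

theorem IsOrthogonalGrading.proj_diagonal (hQ : IsOrthogonalGrading Q)
    (x : (diagonal Q l).domain) (m : ℕ) : Q m (diagonal Q l x) = l m • Q m x :=
  hQ.apply_of_hasSum (hasSum_diagonal x) m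

theorem IsOrthogonalGrading.ext (hQ : IsOrthogonalGrading Q) {x y : H}
    (h : ∀ n, Q n x = Q n y) : x = y :=
  (hQ.hasSum x).unique (by simpa only [h] using hQ.hasSum y)

/-- The components of any vector add up to it, so a candidate `y` with the right components proves
convergence and gives the sum at once. This is how membership in the domain of `diagonal Q l` is
proved below. -/
theorem IsOrthogonalGrading.hasSum_of_proj (hQ : IsOrthogonalGrading Q) {x y : H}
    (h : ∀ n, Q n y = l n • Q n x) : HasSum (fun n => l n • Q n x) y := by
  simpa only [h] using hQ.hasSum y

theorem IsOrthogonalGrading.proj_mem_domain (hQ : IsOrthogonalGrading Q) (x : H) (m : ℕ) :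
    Q m x ∈ (diagonal Q l).domain := by
  refine mem_diagonal_domain.2 ⟨_, hasSum_single m fun n hn => ?_⟩
  rw [hQ.orth n m hn, smul_zero]

theorem IsOrthogonalGrading.diagonal_proj (hQ : IsOrthogonalGrading Q) (x : H) (m : ℕ) :
    diagonal Q l ⟨Q m x, hQ.proj_mem_domain x m⟩ = l m • Q m x := by
  refine hQ.ext fun n => ?_
  rw [hQ.proj_diagonal, map_smul]
  rcases eq_or_ne n m with rfl | h
  · rfl
  · simp [hQ.orth n m h]

theorem IsOrthogonalGrading.dense_domain (hQ : IsOrthogonalGrading Q) :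
    Dense ((diagonal Q l).domain : Set H) := fun x =>
  mem_closure_of_tendsto (hQ.hasSum x)
    (Eventually.of_forall fun _ => Submodule.sum_mem _ fun n _ => hQ.proj_mem_domain x n)

theorem IsOrthogonalGrading.isSelfAdjoint_diagonal [CompleteSpace H] (hQ : IsOrthogonalGrading Q)
    (hl : ∀ n, star (l n) = l n) : IsSelfAdjoint (diagonal Q l) := by
  have hsymm : (diagonal Q l).IsFormalAdjoint (diagonal Q l) := by
    intro x y
    have h1 := (hasSum_diagonal x).mapL (innerSL ℂ (y : H))
    have h2 := (hasSum_diagonal y).mapL (innerSL ℂ (x : H))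
    refine HasSum.unique (L := .unconditional ℕ) (f := fun n => l n * ⟪(x : H), Q n y⟫_ℂ) ?_ ?_
    · have h3 := h1.map (starRingEnd ℂ) Complex.continuous_conj
      simp only [Function.comp_def, innerSL_apply_apply, inner_smul_right, map_mul,
        inner_conj_symm, hQ.inner_left] at h3
      convert h3 using 3 with n
      exact (hl n).symm
    · simpa only [innerSL_apply_apply, inner_smul_right] using h2
  rw [LinearPMap.isSelfAdjoint_def]
  refine le_antisymm ?_ (hsymm.le_adjoint hQ.dense_domain)
  -- Testing the adjoint against the vectors `Q n x` of the domain determines its components, so the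
  -- adjoint is no larger than the diagonal operator.
  have key : ∀ y : (LinearPMap.adjoint (diagonal Q l)).domain,
      HasSum (fun n => l n • Q n (y : H)) (LinearPMap.adjoint (diagonal Q l) y) := by
    intro y
    refine hQ.hasSum_of_proj fun n => ?_
    refine ext_inner_right ℂ fun x => ?_
    rw [hQ.inner_left]
    have := LinearPMap.adjoint_isFormalAdjoint hQ.dense_domain y
      ⟨Q n x, hQ.proj_mem_domain x n⟩
    rw [this, hQ.diagonal_proj, inner_smul_right, inner_smul_left, hQ.inner_left]
    congr 1
    exact (hl n).symm
  exact ⟨fun y hy => ⟨_, key ⟨y, hy⟩⟩, fun y z hyz => by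
    rw [diagonal_apply, ← hyz, (key y).tsum_eq]⟩

theorem IsOrthogonalGrading.summable_smul [CompleteSpace H] (hQ : IsOrthogonalGrading Q)
    (hc : Summable fun n => ‖c n‖) : Summable fun n => c n • Q n := by
  refine Summable.of_norm_bounded hc fun n => ?_
  rw [norm_smul]
  exact mul_le_of_le_one_right (norm_nonneg _) (hQ.norm_le_one n)

theorem IsOrthogonalGrading.hasSum_tsum_apply [CompleteSpace H] (hQ : IsOrthogonalGrading Q)
    (hc : Summable fun n => ‖c n‖) (x : H) :
    HasSum (fun n => c n • Q n x) ((∑' n, c n • Q n) x) := by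
  simpa using (hQ.summable_smul hc).hasSum.mapL (ContinuousLinearMap.apply ℂ H x)

theorem IsOrthogonalGrading.proj_tsum [CompleteSpace H] (hQ : IsOrthogonalGrading Q)
    (hc : Summable fun n => ‖c n‖) (x : H) (m : ℕ) :
    Q m ((∑' n, c n • Q n) x) = c m • Q m x :=
  hQ.apply_of_hasSum (hQ.hasSum_tsum_apply hc x) m

theorem IsOrthogonalGrading.isCompactOperator_tsum [CompleteSpace H] (hQ : IsOrthogonalGrading Q)
    (hc : Summable fun n => ‖c n‖) :
    IsCompactOperator (∑' n, c n • Q n : H →L[ℂ] H) := by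
  refine isCompactOperator_of_tendsto (hQ.summable_smul hc).hasSum (Eventually.of_forall fun s => ?_)
  have : (∑ n ∈ s, c n • Q n) ∈ compactOperator (RingHom.id ℂ) H H :=
    Submodule.sum_mem _ fun n _ => Submodule.smul_mem _ _ (hQ.compact n)
  exact this

theorem IsOrthogonalGrading.hasCompactResolvent [CompleteSpace H] (hQ : IsOrthogonalGrading Q)
    (hl : ∀ n, star (l n) = l n) (hs : ∀ z : ℂ, z.im ≠ 0 → Summable fun n => ‖(l n - z)⁻¹‖) :
    HasCompactResolvent (diagonal Q l) := by
  intro z hz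
  have hne : ∀ n, l n - z ≠ 0 := by
    intro n h
    have h1 : (l n).im = 0 := Complex.conj_eq_iff_im.1 (hl n)
    exact hz (by rw [← sub_eq_zero.1 h, h1])
  -- With `R = ∑ (l n - z)⁻¹ Q n`, the expected value of `D R y` is `y + z R y`.
  have key : ∀ y, HasSum (fun n => l n • Q n ((∑' n, (l n - z)⁻¹ • Q n) y))
      (y + z • (∑' n, (l n - z)⁻¹ • Q n) y) := by
    intro y
    refine hQ.hasSum_of_proj fun n => ?_
    rw [map_add, map_smul, hQ.proj_tsum (hs z hz), smul_smul, smul_smul]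
    have h1 : l n * (l n - z)⁻¹ = 1 + z * (l n - z)⁻¹ := by
      field_simp [hne n]
      ring
    rw [h1]
    module
  refine ⟨∑' n, (l n - z)⁻¹ • Q n, hQ.isCompactOperator_tsum (hs z hz), fun y => ?_, fun x => ?_⟩
  · refine ⟨⟨_, key y⟩, ?_⟩
    rw [diagonal_apply, (key y).tsum_eq, add_sub_cancel_right]
  · refine hQ.ext fun n => ?_
    rw [hQ.proj_tsum (hs z hz), map_sub, map_smul, hQ.proj_diagonal, ← sub_smul, smul_smul,
      inv_mul_cancel₀ (hne n), one_smul]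

theorem IsOrthogonalGrading.isPositive_tsum [CompleteSpace H] (hQ : IsOrthogonalGrading Q)
    {t : ℕ → ℝ} (ht : ∀ n, 0 ≤ t n) (hs : Summable fun n => ‖(t n : ℂ)‖) :
    (∑' n, (t n : ℂ) • Q n).IsPositive := by
  rw [ContinuousLinearMap.isPositive_def]
  have hTx := fun x => hQ.hasSum_tsum_apply hs x
  constructor
  · intro x y
    have h1 := (hTx x).mapL (innerSL ℂ y)
    have h2 := (hTx y).mapL (innerSL ℂ x)
    refine HasSum.unique (L := .unconditional ℕ) (f := fun n => (t n : ℂ) * ⟪(x : H), Q n y⟫_ℂ) ?_ ?_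
    · have h3 := h1.map (starRingEnd ℂ) Complex.continuous_conj
      simp only [Function.comp_def, innerSL_apply_apply, inner_smul_right, map_mul,
        inner_conj_symm, hQ.inner_left, Complex.conj_ofReal] at h3
      exact h3
    · simp only [innerSL_apply_apply, inner_smul_right] at h2
      exact h2
  · intro x
    have h1 := ((hTx x).mapL (innerSL ℂ x)).mapL Complex.reCLM
    simp only [innerSL_apply_apply, inner_smul_right] at h1
    rw [ContinuousLinearMap.reApplyInnerSelf_apply, inner_re_symm]
    refine h1.nonneg fun n => ?_
    rw [← hQ.idem, ← hQ.inner_left, inner_self_eq_norm_sq_to_K]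
    simp only [Complex.reCLM_apply, Complex.coe_algebraMap, ← Complex.ofReal_pow,
      ← Complex.ofReal_mul, Complex.ofReal_re]
    exact mul_nonneg (ht n) (by positivity)

theorem IsOrthogonalGrading.isInvSqrtOneAddSq [CompleteSpace H] (hQ : IsOrthogonalGrading Q)
    {r : ℕ → ℝ}
    (hs : Summable fun n => ‖(((√(1 + r n ^ 2))⁻¹ : ℝ) : ℂ)‖) :
    IsInvSqrtOneAddSq (diagonal Q fun n => (r n : ℂ))
      (∑' n, (((√(1 + r n ^ 2))⁻¹ : ℝ) : ℂ) • Q n) := by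
  set t : ℕ → ℝ := fun n => (√(1 + r n ^ 2))⁻¹ with ht
  have ht2 : ∀ n, (t n : ℂ) * t n * (1 + (r n : ℂ) ^ 2) = 1 := by
    intro n
    have h0 : (0 : ℝ) < 1 + r n ^ 2 := by positivity
    have : t n * t n * (1 + r n ^ 2) = 1 := by
      simp only [ht]
      rw [← mul_inv, Real.mul_self_sqrt h0.le, inv_mul_cancel₀ h0.ne']
    exact_mod_cast this
  set T : H →L[ℂ] H := ∑' n, (t n : ℂ) • Q n with hT
  refine ⟨hQ.isPositive_tsum (fun n => by positivity) hs, fun y => ?_⟩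
  have hp : ∀ n, Q n (T (T y)) = ((t n : ℂ) * t n) • Q n y := fun n => by
    rw [hT, hQ.proj_tsum hs, hQ.proj_tsum hs, smul_smul]
  -- Since `|r n| t n ≤ 1`, the coefficients `r n (t n)²` of `D T²` are dominated by `t n`, so that
  -- `D T²` is again a norm-convergent series.
  have hb : ∀ n, ‖(r n : ℂ) * ((t n : ℂ) * t n)‖ ≤ ‖(t n : ℂ)‖ := by
    intro n
    have h0 : (0 : ℝ) < 1 + r n ^ 2 := by positivity
    have h1 : |r n| * t n ≤ 1 := by
      simp only [ht]
      rw [← div_eq_mul_inv, div_le_one (by positivity)]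
      exact Real.abs_le_sqrt (by linarith)
    rw [norm_mul, norm_mul, ← mul_assoc]
    refine mul_le_of_le_one_left (norm_nonneg _) ?_
    have h2 : (0 : ℝ) ≤ t n := by positivity
    simpa [abs_of_nonneg h2] using h1
  have hs' := Summable.of_nonneg_of_le (fun n => norm_nonneg _) hb hs
  have k1 : HasSum (fun n => (r n : ℂ) • Q n (T (T y)))
      ((∑' n, ((r n : ℂ) * ((t n : ℂ) * t n)) • Q n) y) := by
    refine hQ.hasSum_of_proj fun n => ?_
    rw [hQ.proj_tsum hs', hp, smul_smul]
  refine ⟨⟨_, k1⟩, ?_⟩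
  have e1 : diagonal Q (fun n => (r n : ℂ)) ⟨T (T y), ⟨_, k1⟩⟩ =
      (∑' n, ((r n : ℂ) * ((t n : ℂ) * t n)) • Q n) y := by
    rw [diagonal_apply, k1.tsum_eq]
  have k2 : HasSum (fun n => (r n : ℂ) • Q n
      (diagonal Q (fun n => (r n : ℂ)) ⟨T (T y), ⟨_, k1⟩⟩)) (y - T (T y)) := by
    refine hQ.hasSum_of_proj fun n => ?_
    rw [e1, hQ.proj_tsum hs', map_sub, hp, smul_smul]
    have h1 : (r n : ℂ) * (r n * (t n * t n)) = 1 - t n * t n := by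
      linear_combination ht2 n
    rw [h1]
    module
  refine ⟨⟨_, k2⟩, ?_⟩
  rw [diagonal_apply _, k2.tsum_eq, add_sub_cancel]

/-- Bessel's inequality, summed over an orthonormal basis of a finite-dimensional subspace. -/
theorem sum_norm_sq_starProjection_le {ι : Type*} {b : ι → H} (hb : Orthonormal ℂ b)
    (V : Submodule ℂ H) [FiniteDimensional ℂ V] (s : Finset ι) :
    ∑ i ∈ s, ‖V.starProjection (b i)‖ ^ 2 ≤ Module.finrank ℂ V := by
  set e := stdOrthonormalBasis ℂ V
  have h1 : ∀ i, ‖V.starProjection (b i)‖ ^ 2 = ∑ j, ‖⟪b i, (e j : H)⟫_ℂ‖ ^ 2 := by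
    intro i
    have h2 := e.sum_sq_norm_inner_left (V.orthogonalProjectionOnto (b i))
    rw [Submodule.starProjection_apply, Submodule.norm_coe, ← h2]
    refine Finset.sum_congr rfl fun j _ => ?_
    rw [Submodule.coe_inner, ← Submodule.starProjection_apply,
      Submodule.inner_starProjection_left_eq_right,
      Submodule.starProjection_eq_self_iff.2 (e j).2]
  calc ∑ i ∈ s, ‖V.starProjection (b i)‖ ^ 2
      = ∑ j, ∑ i ∈ s, ‖⟪b i, (e j : H)⟫_ℂ‖ ^ 2 := by
        simp only [h1]; rw [Finset.sum_comm]
    _ ≤ ∑ j, (1 : ℝ) := by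
        refine Finset.sum_le_sum fun j _ => (hb.sum_inner_products_le (e j : H)).trans ?_
        have := e.orthonormal.1 j
        rw [← Submodule.norm_coe] at this
        rw [this, one_pow]
    _ = _ := by simp

/-- On finitely many basis vectors the two sums can be exchanged, and by Bessel's inequality index
`n` then contributes at most `t n` times the dimension of `V n`. Only the inclusion of the range of
`Q n` in `V n` is needed. -/
theorem IsOrthogonalGrading.hasFiniteTrace_tsum.{u} {H : Type u} [NormedAddCommGroup H]
    [InnerProductSpace ℂ H] [CompleteSpace H] {Q : ℕ → H →L[ℂ] H} (hQ : IsOrthogonalGrading Q)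
    (V : ℕ → Submodule ℂ H) [∀ n, FiniteDimensional ℂ (V n)] (hV : ∀ n x, Q n x ∈ V n)
    {t : ℕ → ℝ} (ht : ∀ n, 0 ≤ t n) (hs : Summable fun n => ‖(t n : ℂ)‖)
    (hs' : Summable fun n => t n * Module.finrank ℂ (V n)) :
    HasFiniteTrace (∑' n, (t n : ℂ) • Q n) := by
  intro ι b
  have hle : ∀ n x, ‖Q n x‖ ≤ ‖(V n).starProjection x‖ := by
    intro n x
    -- `Q n` is symmetric with range in `V n`, so it kills the orthogonal complement of `V n`.
    have h1 : Q n x = Q n ((V n).starProjection x) := by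
      rw [← sub_eq_zero, ← map_sub, ← inner_self_eq_zero (𝕜 := ℂ), hQ.inner_left, hQ.idem]
      exact Submodule.starProjection_inner_eq_zero _ _ (hV n _)
    rw [h1]
    exact (Q n).le_of_opNorm_le (hQ.norm_le_one n) _ |>.trans_eq (one_mul _)
  have hsum : ∀ x, HasSum (fun n => t n * ‖Q n x‖ ^ 2) (⟪x, (∑' n, (t n : ℂ) • Q n) x⟫_ℂ).re := by
    intro x
    have h1 := ((hQ.hasSum_tsum_apply hs x).mapL (innerSL ℂ x)).mapL Complex.reCLM
    simp only [innerSL_apply_apply, inner_smul_right] at h1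
    refine h1.congr_fun ?_
    intro n
    rw [← hQ.idem, ← hQ.inner_left, inner_self_eq_norm_sq_to_K]
    simp [← Complex.ofReal_pow, ← Complex.ofReal_mul, hQ.idem]
  refine summable_of_sum_le (c := ∑' n, t n * Module.finrank ℂ (V n))
    (fun i => (hsum (b i)).nonneg fun n => mul_nonneg (ht n) (sq_nonneg _)) fun s => ?_
  refine hasSum_le (fun n => ?_) (hasSum_sum fun i _ => hsum (b i)) hs'.hasSum
  rw [← Finset.mul_sum]
  refine mul_le_mul_of_nonneg_left ?_ (ht n)
  exact (Finset.sum_le_sum fun i _ => pow_le_pow_left₀ (norm_nonneg _) (hle n (b i)) 2).trans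
    (sum_norm_sq_starProjection_le b.orthonormal (V n) s)

/-- The terms of `[D, T]` with index at least `m` vanish; the remaining finite sum `B` is a bounded
operator, whatever the coefficients `l n`. -/
theorem hasBoundedCommutator_diagonal {T : H →L[ℂ] H}
    (m : ℕ) (hT : ∀ n, m ≤ n → ∀ x, Q n (T x) = T (Q n x)) :
    HasBoundedCommutator (diagonal Q l) T := by
  set B : H →L[ℂ] H := ∑ n ∈ Finset.range m, l n • (Q n ∘L T - T ∘L Q n) with hB
  have key : ∀ x : (diagonal Q l).domain,
      HasSum (fun n => l n • Q n (T x)) (T (diagonal Q l x) + B x) := by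
    intro x
    have h1 : HasSum (fun n => l n • (Q n (T x) - T (Q n x))) (B x) := by
      have : B x = ∑ n ∈ Finset.range m, l n • (Q n (T x) - T (Q n x)) := by
        simp [hB]
      rw [this]
      refine hasSum_sum_of_ne_finset_zero fun n hn => ?_
      rw [hT n (by simpa using hn), sub_self, smul_zero]
    have h2 := ((hasSum_diagonal x).mapL T).add h1
    convert h2 using 2 with n
    rw [map_smul, ← smul_add, add_sub_cancel]
  refine ⟨fun x hx => ⟨_, key ⟨x, hx⟩⟩, ‖B‖, fun x => ?_⟩
  rw [diagonal_apply, (key x).tsum_eq, add_sub_cancel_left]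
  exact B.le_opNorm _

end Grading

/-! ### The grading attached to an increasing sequence of finite-dimensional subspaces. -/

section Filtered

variable {H : Type*} [NormedAddCommGroup H] [InnerProductSpace ℂ H]
  (V : ℕ → Submodule ℂ H) [∀ n, FiniteDimensional ℂ (V n)]

/-- The successive differences of the orthogonal projections onto an increasing sequence of
subspaces. -/
noncomputable def projDiff : ℕ → H →L[ℂ] H
  | 0 => (V 0).starProjection
  | n + 1 => (V (n + 1)).starProjection - (V n).starProjection

theorem sum_projDiff (n : ℕ) :
    ∑ i ∈ Finset.range (n + 1), projDiff V i = (V n).starProjection := by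
  induction n with
  | zero => simp [projDiff]
  | succ n ih => rw [Finset.sum_range_succ, ih, projDiff, add_sub_cancel]

variable {V}

theorem projDiff_mem (hV : Monotone V) (n : ℕ) (x : H) : projDiff V n x ∈ V n := by
  cases n with
  | zero => exact Submodule.starProjection_apply_mem _ _
  | succ n =>
    exact Submodule.sub_mem _ (Submodule.starProjection_apply_mem _ _)
      (hV n.le_succ (Submodule.starProjection_apply_mem _ _))

theorem projDiff_inner_left (n : ℕ) (x y : H) :
    ⟪projDiff V n x, y⟫_ℂ = ⟪x, projDiff V n y⟫_ℂ := by
  cases n with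
  | zero => exact Submodule.inner_starProjection_left_eq_right _ _ _
  | succ n =>
    simp only [projDiff, sub_apply, inner_sub_left, inner_sub_right,
      Submodule.inner_starProjection_left_eq_right]

theorem projDiff_apply_of_mem (hV : Monotone V) {m n : ℕ} (h : m < n) {x : H} (hx : x ∈ V m) :
    projDiff V n x = 0 := by
  obtain ⟨k, rfl⟩ : ∃ k, n = k + 1 := ⟨n - 1, by omega⟩
  rw [projDiff, sub_apply, Submodule.starProjection_eq_self_iff.2 (hV h.le hx),
    Submodule.starProjection_eq_self_iff.2 (hV (by omega : m ≤ k) hx), sub_self]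

theorem projDiff_orth (hV : Monotone V) {m n : ℕ} (h : m ≠ n) (x : H) :
    projDiff V m (projDiff V n x) = 0 := by
  rcases h.lt_or_gt with h | h
  · refine ext_inner_right ℂ fun y => ?_
    rw [projDiff_inner_left, projDiff_inner_left,
      projDiff_apply_of_mem hV h (projDiff_mem hV m y), inner_zero_right, inner_zero_left]
  · exact projDiff_apply_of_mem hV h (projDiff_mem hV n x)

theorem projDiff_idem (hV : Monotone V) (n : ℕ) (x : H) :
    projDiff V n (projDiff V n x) = projDiff V n x := by
  have h1 := congrArg (fun P : H →L[ℂ] H => P (projDiff V n x)) (sum_projDiff V n)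
  simp only [_root_.sum_apply] at h1
  rw [Submodule.starProjection_eq_self_iff.2 (projDiff_mem hV n x),
    Finset.sum_eq_single n (fun m _ hm => projDiff_orth hV hm x) (by simp)] at h1
  exact h1

theorem sum_norm_sq_projDiff_le (hV : Monotone V) (s : Finset ℕ) (x : H) :
    ∑ n ∈ s, ‖projDiff V n x‖ ^ 2 ≤ ‖x‖ ^ 2 := by
  obtain ⟨N, hN⟩ : ∃ N, s ⊆ Finset.range (N + 1) := by
    obtain ⟨N, hN⟩ := s.exists_nat_subset_range
    exact ⟨N, hN.trans (Finset.range_mono N.le_succ)⟩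
  calc ∑ n ∈ s, ‖projDiff V n x‖ ^ 2
      ≤ ∑ n ∈ Finset.range (N + 1), ‖projDiff V n x‖ ^ 2 :=
        Finset.sum_le_sum_of_subset_of_nonneg hN fun _ _ _ => sq_nonneg _
    _ = ∑ n ∈ Finset.range (N + 1), (⟪x, projDiff V n x⟫_ℂ).re := by
        refine Finset.sum_congr rfl fun n _ => ?_
        rw [← projDiff_idem hV n x, ← projDiff_inner_left, projDiff_idem hV n x]
        exact (inner_self_eq_norm_sq (𝕜 := ℂ) _).symm
    _ = (⟪x, (V N).starProjection x⟫_ℂ).re := by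
        rw [← sum_projDiff, _root_.sum_apply, inner_sum, Complex.re_sum]
    _ ≤ ‖x‖ * ‖(V N).starProjection x‖ := re_inner_le_norm (𝕜 := ℂ) _ _
    _ ≤ ‖x‖ ^ 2 := by
        rw [sq]
        exact mul_le_mul_of_nonneg_left ((V N).norm_starProjection_apply_le x) (norm_nonneg _)

/-- Orthogonality and the bound on the squared norms give unconditional convergence. The sum is then
read off from the initial segments, which telescope to the projections onto `V n` and tend to the
identity by density. -/
theorem hasSum_projDiff [CompleteSpace H] (hV : Monotone V) (hd : Dense ((⨆ n, V n : Submodule ℂ H) : Set H))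
    (x : H) : HasSum (fun n => projDiff V n x) x := by
  have hs : Summable fun n => projDiff V n x := by
    have horth : OrthogonalFamily ℂ (fun n => LinearMap.range (projDiff V n).toLinearMap)
        fun n => (LinearMap.range (projDiff V n).toLinearMap).subtypeₗᵢ := by
      rintro m n hmn ⟨_, y, rfl⟩ ⟨_, z, rfl⟩
      simp only [Submodule.coe_subtypeₗᵢ, Submodule.subtype_apply, ContinuousLinearMap.coe_coe]
      rw [projDiff_inner_left, projDiff_orth hV hmn, inner_zero_right]
    have := (horth.summable_iff_norm_sq_summable
      fun n => ⟨projDiff V n x, LinearMap.mem_range_self _ x⟩).2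
      (summable_of_sum_le (fun _ => sq_nonneg _) fun s => sum_norm_sq_projDiff_le hV s x)
    simpa using this
  have h1 := (tendsto_add_atTop_iff_nat 1).2 hs.hasSum.tendsto_sum_nat
  have h2 := Submodule.starProjection_tendsto_self V hV x
    (by rw [Submodule.dense_iff_topologicalClosure_eq_top.1 hd])
  have h3 : ∀ n, ∑ i ∈ Finset.range (n + 1), projDiff V i x = (V n).starProjection x := by
    intro n
    rw [← sum_projDiff, _root_.sum_apply]
  simp only [h3] at h1
  have h4 := hs.hasSum
  rwa [tendsto_nhds_unique h1 h2] at h4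

theorem isOrthogonalGrading_projDiff [CompleteSpace H] (hV : Monotone V)
    (hd : Dense ((⨆ n, V n : Submodule ℂ H) : Set H)) : IsOrthogonalGrading (projDiff V) where
  inner_left := projDiff_inner_left
  idem := projDiff_idem hV
  orth _ _ h x := projDiff_orth hV h x
  hasSum := hasSum_projDiff hV hd
  compact n := by
    have h0 : ∀ n, IsCompactOperator (V n).starProjection := fun n =>
      (isCompactOperator_of_locallyCompactSpace_dom
        (V n).orthogonalProjectionOnto).clm_comp (V n).subtypeL
    cases n with
    | zero => exact h0 0
    | succ n => exact (h0 (n + 1)).sub (h0 n)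

/-- An operator that preserves `V n` together with its adjoint commutes with the projection. -/
theorem starProjection_comm {V : Submodule ℂ H} [V.HasOrthogonalProjection] {T S : H →L[ℂ] H}
    (hTS : ∀ x y, ⟪T x, y⟫_ℂ = ⟪x, S y⟫_ℂ) (hT : ∀ x ∈ V, T x ∈ V) (hS : ∀ x ∈ V, S x ∈ V)
    (x : H) : V.starProjection (T x) = T (V.starProjection x) := by
  refine Submodule.eq_starProjection_of_mem_of_inner_eq_zero
    (hT _ (Submodule.starProjection_apply_mem _ _)) (fun w hw => ?_)
  rw [← map_sub, hTS]
  exact Submodule.starProjection_inner_eq_zero _ _ (hS w hw)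

end Filtered

end Schottky

/-! ### Prefixes of reduced words and the boundary of the free group. -/

namespace Schottky

section Words

variable {g : ℕ}

/-- The first `k` letters of the reduced word representing `u`. -/
def wordPrefix (k : ℕ) (u : FreeGroup (Fin g)) : List (Fin g × Bool) := u.toWord.take k

/-- The list of the first `k` letters of the infinite word `ξ`. -/
def initialList (ξ : ℕ → Fin g × Bool) (k : ℕ) : List (Fin g × Bool) :=
  List.ofFn fun i : Fin k => ξ i

/-- Right multiplication by a letter either appends it or cancels the last letter, so it can only
affect the end of a word. -/
theorem wordPrefix_mul_letter {N : ℕ} {x : FreeGroup (Fin g)} (s : Fin g × Bool)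
    (h : N + 1 ≤ x.norm) : wordPrefix N (x * FreeGroup.mk [s]) = wordPrefix N x ∧
      x.norm ≤ (x * FreeGroup.mk [s]).norm + 1 := by
  obtain ⟨M, t, hM⟩ : ∃ M t, x.toWord = M ++ [t] := by
    rcases List.eq_nil_or_concat x.toWord with h0 | ⟨M, t, h0⟩
    · simp [FreeGroup.norm, h0] at h
    · exact ⟨M, t, by simpa using h0⟩
  have hred : FreeGroup.IsReduced (M ++ [t]) := hM ▸ FreeGroup.isReduced_toWord
  have hx : x = FreeGroup.mk (M ++ [t]) := by rw [← hM, FreeGroup.mk_toWord]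
  have hlen : N ≤ M.length := by simpa [FreeGroup.norm, hM] using h
  by_cases hts : t.1 = s.1 → t.2 = s.2
  · have h1 : FreeGroup.IsReduced (M ++ [t] ++ [s]) :=
      hred.append_overlap (FreeGroup.isReduced_cons_cons.2 ⟨hts, .singleton⟩) (by simp)
    have h2 : (x * FreeGroup.mk [s]).toWord = M ++ [t] ++ [s] := by
      rw [hx, FreeGroup.mul_mk, FreeGroup.toWord_mk, h1.reduce_eq]
    simp only [wordPrefix, FreeGroup.norm, h2, hM]
    constructor
    · rw [List.take_append_of_le_length (by simp; omega)]
    · simp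
  · push Not at hts
    have ht : t = (s.1, !s.2) := by
      ext
      · exact congrArg Fin.val hts.1
      · have := hts.2
        cases h1 : t.2 <;> cases h2 : s.2 <;> simp_all
    have h1 : FreeGroup.IsReduced M := hred.infix ⟨[], [t], by simp⟩
    have h2 : (x * FreeGroup.mk [s]).toWord = M := by
      have : FreeGroup.mk [t] * FreeGroup.mk [s] = 1 := by
        rw [ht, FreeGroup.mul_mk, FreeGroup.one_eq_mk]
        exact Quot.sound (by simpa using FreeGroup.Red.Step.not_rev (L₁ := []) (L₂ := []) (x := s.1) (b := s.2))
      rw [hx, ← FreeGroup.mul_mk, mul_assoc, this, mul_one, FreeGroup.toWord_mk, h1.reduce_eq]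
    simp only [wordPrefix, FreeGroup.norm, h2, hM]
    constructor
    · rw [List.take_append_of_le_length hlen]
    · simp

theorem wordPrefix_mul {N : ℕ} {x y : FreeGroup (Fin g)} (h : N + y.norm ≤ x.norm) :
    wordPrefix N (x * y) = wordPrefix N x := by
  have key : ∀ (L : List (Fin g × Bool)) (x : FreeGroup (Fin g)), N + L.length ≤ x.norm →
      wordPrefix N (x * FreeGroup.mk L) = wordPrefix N x := by
    intro L
    induction L with
    | nil => intro x _; rw [← FreeGroup.one_eq_mk, mul_one]
    | cons s L ih =>
      intro x hx
      rw [List.length_cons] at hx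
      have h1 := wordPrefix_mul_letter (N := N) (x := x) s (by omega)
      have h2 : FreeGroup.mk (s :: L) = FreeGroup.mk [s] * FreeGroup.mk L := by
        rw [FreeGroup.mul_mk]; rfl
      rw [h2, ← mul_assoc, ih _ (by omega), h1.1]
  simpa [FreeGroup.mk_toWord] using key y.toWord x h

theorem finite_norm_lt (m : ℕ) : {w : FreeGroup (Fin g) | w.norm < m}.Finite :=
  ((List.finite_length_lt (Fin g × Bool) m).preimage
    FreeGroup.toWord_injective.injOn).subset fun _ hw => hw

theorem tendsto_norm_cofinite :
    Tendsto (FreeGroup.norm : FreeGroup (Fin g) → ℕ) cofinite atTop := by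
  refine tendsto_atTop.2 fun m => ?_
  filter_upwards [(finite_norm_lt m).compl_mem_cofinite] with w hw
  simpa using hw

theorem toWord_mk_take (u : FreeGroup (Fin g)) (j : ℕ) :
    (FreeGroup.mk (u.toWord.take j)).toWord = u.toWord.take j := by
  rw [FreeGroup.toWord_mk]
  exact (FreeGroup.isReduced_toWord.infix (List.take_prefix _ _).isInfix).reduce_eq

/-- An injective endomorphism of the free group is uniformly continuous for the
prefix topology. -/
theorem exists_wordPrefix_map_eq {f : FreeGroup (Fin g) →* FreeGroup (Fin g)}
    (hf : Function.Injective f) (N : ℕ) :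
    ∃ k, ∀ u v : FreeGroup (Fin g), k ≤ u.norm → k ≤ v.norm → wordPrefix k u = wordPrefix k v →
      wordPrefix N (f u) = wordPrefix N (f v) := by
  obtain ⟨C, hC⟩ : ∃ C, ∀ s : Fin g × Bool, (f (FreeGroup.mk [s])).norm ≤ C := by
    obtain ⟨C, hC⟩ := (Set.finite_range fun s : Fin g × Bool => (f (FreeGroup.mk [s])).norm).bddAbove
    exact ⟨C, fun s => hC ⟨s, rfl⟩⟩
  -- By injectivity only finitely many words have an image of norm below `N + C`; `k` exceeds their
  -- norms.
  obtain ⟨k, hk⟩ : ∃ k, ∀ u : FreeGroup (Fin g), k ≤ u.norm → N + C ≤ (f u).norm := by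
    obtain ⟨k, hk⟩ := (((finite_norm_lt (N + C)).preimage hf.injOn).image
      (FreeGroup.norm : FreeGroup (Fin g) → ℕ)).bddAbove
    refine ⟨k + 1, fun u hu => ?_⟩
    by_contra! h
    have := hk ⟨u, h, rfl⟩
    omega
  -- Beyond length `k`, adding a letter multiplies the image on the right by an element of norm at
  -- most `C`, too short to cancel back into the first `N` letters.
  have key : ∀ u : FreeGroup (Fin g), ∀ j, k ≤ j → j ≤ u.norm →
      wordPrefix N (f (FreeGroup.mk (u.toWord.take j))) =
        wordPrefix N (f (FreeGroup.mk (u.toWord.take k))) := by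
    intro u j hj
    induction j, hj using Nat.le_induction with
    | base => intro _; rfl
    | succ j hj ih =>
      intro hu
      have hj' : j < u.toWord.length := hu
      rw [← ih (by omega), List.take_succ_eq_append_getElem hj', ← FreeGroup.mul_mk, map_mul]
      refine wordPrefix_mul ?_
      refine (Nat.add_le_add_left (hC _) N).trans (hk _ ?_)
      rw [FreeGroup.norm, toWord_mk_take, List.length_take]
      omega
  refine ⟨k, fun u v hu hv huv => ?_⟩
  have h1 := key u u.norm hu le_rfl
  have h2 := key v v.norm hv le_rfl
  rw [FreeGroup.norm, List.take_length, FreeGroup.mk_toWord] at h1 h2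
  rw [h1, h2]
  change u.toWord.take k = v.toWord.take k at huv
  rw [huv]

theorem initialList_succ (ξ : ℕ → Fin g × Bool) (k : ℕ) :
    initialList ξ (k + 1) = initialList ξ k ++ [ξ k] := by
  rw [initialList, List.ofFn_succ', List.concat_eq_append]
  rfl

theorem length_initialList (ξ : ℕ → Fin g × Bool) (k : ℕ) : (initialList ξ k).length = k := by
  simp [initialList]

theorem getElem_initialList (ξ : ℕ → Fin g × Bool) (k i : ℕ) (h : i < (initialList ξ k).length) :
    (initialList ξ k)[i] = ξ i := by
  simp [initialList]

theorem take_initialList (ξ : ℕ → Fin g × Bool) {k n : ℕ} (h : k ≤ n) :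
    (initialList ξ n).take k = initialList ξ k := by
  refine List.ext_getElem (by simp [length_initialList, h]) fun i h1 h2 => ?_
  rw [List.getElem_take, getElem_initialList, getElem_initialList]

theorem initialList_eq_iff {ξ ξ' : ℕ → Fin g × Bool} {k : ℕ} :
    initialList ξ k = initialList ξ' k ↔ ∀ i < k, ξ i = ξ' i := by
  rw [initialList, initialList, List.ofFn_inj, funext_iff]
  exact ⟨fun h i hi => h ⟨i, hi⟩, fun h i => h i i.2⟩

theorem isReduced_initialList {ξ : ℕ → Fin g × Bool} (hξ : IsInfiniteReducedWord ξ) (k : ℕ) :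
    FreeGroup.IsReduced (initialList ξ k) := by
  rw [FreeGroup.IsReduced, List.isChain_iff_getElem]
  intro i hi
  simp only [getElem_initialList]
  exact hξ i

theorem toWord_initialWord {ξ : ℕ → Fin g × Bool} (hξ : IsInfiniteReducedWord ξ) (k : ℕ) :
    (initialWord ξ k).toWord = initialList ξ k :=
  FreeGroup.toWord_mk.trans (isReduced_initialList hξ k).reduce_eq

theorem norm_initialWord {ξ : ℕ → Fin g × Bool} (hξ : IsInfiniteReducedWord ξ) (k : ℕ) :
    (initialWord ξ k).norm = k := by
  rw [FreeGroup.norm, toWord_initialWord hξ, length_initialList]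

theorem wordPrefix_initialWord {ξ : ℕ → Fin g × Bool} (hξ : IsInfiniteReducedWord ξ) {k n : ℕ}
    (h : k ≤ n) : wordPrefix k (initialWord ξ n) = initialList ξ k := by
  rw [wordPrefix, toWord_initialWord hξ, take_initialList ξ h]

theorem tendsto_initialWord {ξ : ℕ → Fin g × Bool} (hξ : IsInfiniteReducedWord ξ) :
    Tendsto (initialWord ξ) atTop cofinite := by
  rw [← Nat.cofinite_eq_atTop]
  exact Function.Injective.tendsto_cofinite fun m n h => by
    rw [← norm_initialWord hξ m, h, norm_initialWord hξ n]

theorem length_le_of_wordPrefix_eq {ξ : ℕ → Fin g × Bool} {k : ℕ} {u : FreeGroup (Fin g)}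
    (h : wordPrefix k u = initialList ξ k) : k ≤ u.norm := by
  have := congrArg List.length h
  rw [length_initialList, wordPrefix, List.length_take] at this
  exact (min_eq_left_iff.1 this)

/-- Every nonprincipal ultrafilter on the free group converges to an infinite reduced word. -/
theorem exists_infiniteWord_of_ultrafilter {U : Ultrafilter (FreeGroup (Fin g))}
    (hU : (U : Filter (FreeGroup (Fin g))) ≤ cofinite) :
    ∃ η : ℕ → Fin g × Bool, IsInfiniteReducedWord η ∧
      ∀ k, ∀ᶠ u in (U : Filter (FreeGroup (Fin g))), wordPrefix k u = initialList η k := by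
  have hlen : ∀ k, ∀ᶠ u in (U : Filter (FreeGroup (Fin g))), k ≤ u.norm := fun k =>
    (tendsto_norm_cofinite.mono_left hU).eventually_ge_atTop k
  -- The alphabet is finite, so the ultrafilter selects one letter at each place.
  have h1 : ∀ i : ℕ, ∃ s : Fin g × Bool,
      ∀ᶠ u in (U : Filter (FreeGroup (Fin g))), u.toWord[i]? = some s := by
    intro i
    rw [← Ultrafilter.eventually_exists_iff]
    filter_upwards [hlen (i + 1)] with u hu
    exact ⟨u.toWord[i]'hu, List.getElem?_eq_getElem _⟩
  choose η hη using h1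
  refine ⟨η, fun n => ?_, fun k => ?_⟩
  · obtain ⟨u, hu, hu'⟩ := ((hη n).and (hη (n + 1))).exists
    obtain ⟨h2, h3⟩ := List.getElem?_eq_some_iff.1 hu'
    obtain ⟨h4, h5⟩ := List.getElem?_eq_some_iff.1 hu
    have := List.isChain_iff_getElem.1 (FreeGroup.isReduced_toWord (x := u)) n h2
    rwa [h3, h5] at this
  · have h2 : ∀ᶠ u in (U : Filter (FreeGroup (Fin g))), ∀ i ∈ Finset.range k,
        u.toWord[i]? = some (η i) := (Filter.eventually_all_finset _).2 fun i _ => hη i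
    filter_upwards [h2, hlen k] with u hu hk
    have hk' : k ≤ u.toWord.length := hk
    refine List.ext_getElem (by simp [wordPrefix, length_initialList, hk']) fun i h3 h4 => ?_
    rw [getElem_initialList]
    rw [length_initialList] at h4
    have := hu i (Finset.mem_range.2 h4)
    rw [List.getElem?_eq_getElem (by omega), Option.some_inj] at this
    simpa [wordPrefix] using this

/-- An infinite reduced word can be changed at any given place. -/
theorem exists_infiniteWord_ne (hg : 2 ≤ g) {ξ : ℕ → Fin g × Bool} (hξ : IsInfiniteReducedWord ξ)
    (n : ℕ) : ∃ ξ', IsInfiniteReducedWord ξ' ∧ (∀ i < n, ξ' i = ξ i) ∧ ξ' n ≠ ξ n := by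
  have : Nontrivial (Fin g) := Fin.nontrivial_iff_two_le.2 hg
  obtain ⟨j, hj⟩ := exists_ne (ξ n).1
  -- The new tail is constant, with a generator other than that of `ξ n`. Its sign is copied from
  -- the preceding letter, which rules out cancellation at the junction; for `n = 0` there is no
  -- junction and any sign would do.
  refine ⟨fun i => if i < n then ξ i else (j, (ξ (n - 1)).2), fun i => ?_, fun i hi => if_pos hi,
    fun h => hj ?_⟩
  · dsimp only
    rcases lt_trichotomy (i + 1) n with h | h | h
    · rw [if_pos h, if_pos (by omega)]
      exact hξ i
    · rw [if_pos (by omega), if_neg (by omega)]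
      intro _
      rw [← h]
      rfl
    · rw [if_neg (by omega), if_neg (by omega)]
      exact fun _ => rfl
  · simpa using congrArg Prod.fst h

end Words

end Schottky

/-! ### Limits of Möbius transformations in homogeneous coordinates. -/

namespace Schottky

section Moebius

/-- The point of the Riemann sphere with given homogeneous coordinates. -/
noncomputable def ofHomogeneous (v : Fin 2 → ℂ) : Sphere :=
  if v 1 = 0 then OnePoint.infty else ((v 0 / v 1 : ℂ) : Sphere)

theorem ofHomogeneous_smul {c : ℂ} (hc : c ≠ 0) (v : Fin 2 → ℂ) :
    ofHomogeneous (c • v) = ofHomogeneous v := by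
  simp [ofHomogeneous, hc, mul_div_mul_left]

theorem exists_ofHomogeneous_eq (x : Sphere) :
    ∃ v : Fin 2 → ℂ, ‖v‖ = 1 ∧ ofHomogeneous v = x := by
  obtain ⟨v, hv, rfl⟩ : ∃ v : Fin 2 → ℂ, v ≠ 0 ∧ ofHomogeneous v = x := by
    induction x using OnePoint.rec with
    | infty => exact ⟨![1, 0], fun h => by simpa using congrFun h 0, by simp [ofHomogeneous]⟩
    | coe z => exact ⟨![z, 1], fun h => by simpa using congrFun h 1, by simp [ofHomogeneous]⟩
  refine ⟨((‖v‖⁻¹ : ℝ) : ℂ) • v, ?_, ofHomogeneous_smul (by simpa using hv) v⟩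
  rw [norm_smul]
  simp [hv]

theorem ofHomogeneous_eq_iff {v w : Fin 2 → ℂ} (hv : v ≠ 0) (hw : w ≠ 0) :
    ofHomogeneous v = ofHomogeneous w ↔ v 0 * w 1 = v 1 * w 0 := by
  have h0 : ∀ {v : Fin 2 → ℂ}, v ≠ 0 → v 1 = 0 → v 0 ≠ 0 := fun hv h1 h0 =>
    hv (funext fun i => by fin_cases i <;> simp [h0, h1])
  unfold ofHomogeneous
  by_cases h1 : v 1 = 0 <;> by_cases h2 : w 1 = 0
  · simp [h1, h2]
  · simp [h1, h2, h0 hv h1]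
  · simp [h1, h2, h0 hw h2]
  · rw [if_neg h1, if_neg h2, OnePoint.coe_eq_coe, div_eq_div_iff h1 h2, mul_comm (w 0)]

theorem smul_ofHomogeneous (A : GL (Fin 2) ℂ) {v : Fin 2 → ℂ} (hv : v ≠ 0) :
    A • ofHomogeneous v = ofHomogeneous (A.val.mulVec v) := by
  by_cases h1 : v 1 = 0
  · have h0 : v 0 ≠ 0 := fun h0 => hv (funext fun i => by fin_cases i <;> simp [h0, h1])
    have e1 : ofHomogeneous v = OnePoint.infty := by simp [ofHomogeneous, h1]
    rw [e1, OnePoint.smul_infty_eq_ite]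
    simp [ofHomogeneous, h1, h0, mul_div_mul_right]
  · have e1 : ofHomogeneous v = ((v 0 / v 1 : ℂ) : Sphere) := by simp [ofHomogeneous, h1]
    have e2 : A.val 1 0 * (v 0 / v 1) + A.val 1 1 = (A.val 1 0 * v 0 + A.val 1 1 * v 1) / v 1 := by
      field_simp
    have e3 : A.val 0 0 * (v 0 / v 1) + A.val 0 1 = (A.val 0 0 * v 0 + A.val 0 1 * v 1) / v 1 := by
      field_simp
    rw [e1, OnePoint.smul_some_eq_ite, e2, e3, div_div_div_cancel_right₀ h1]
    simp [ofHomogeneous, h1]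

theorem continuousAt_ofHomogeneous {v : Fin 2 → ℂ} (hv : v ≠ 0) :
    ContinuousAt ofHomogeneous v := by
  by_cases h1 : v 1 = 0
  · have h0 : v 0 ≠ 0 := fun h0 => hv (funext fun i => by fin_cases i <;> simp [h0, h1])
    have e1 : ofHomogeneous v = OnePoint.infty := by simp [ofHomogeneous, h1]
    rw [ContinuousAt, e1, OnePoint.hasBasis_nhds_infty.tendsto_right_iff]
    rintro s ⟨-, hs⟩
    obtain ⟨R, hR⟩ := hs.isBounded.exists_norm_le
    have h2 : ∀ᶠ w : Fin 2 → ℂ in 𝓝 v, R * ‖w 1‖ < ‖w 0‖ := by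
      refine ContinuousAt.eventually_lt
        (continuous_const.mul (continuous_apply 1).norm).continuousAt
        (continuous_apply 0).norm.continuousAt ?_
      simpa [h1] using h0
    filter_upwards [h2] with w hw
    by_cases hw1 : w 1 = 0
    · right; simp [ofHomogeneous, hw1]
    · left
      refine ⟨w 0 / w 1, fun hmem => ?_, by simp [ofHomogeneous, hw1]⟩
      have := hR _ hmem
      rw [norm_div, div_le_iff₀ (norm_pos_iff.2 hw1)] at this
      exact this.not_gt hw
  · have h2 : ∀ᶠ w : Fin 2 → ℂ in 𝓝 v, w 1 ≠ 0 :=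
      (continuous_apply 1).continuousAt.eventually_ne h1
    have h3 : ContinuousAt (fun w : Fin 2 → ℂ => ((w 0 / w 1 : ℂ) : Sphere)) v :=
      OnePoint.continuous_coe.continuousAt.comp
        ((continuous_apply 0).continuousAt.div (continuous_apply 1).continuousAt h1)
    refine h3.congr ?_
    filter_upwards [h2] with w hw
    simp [ofHomogeneous, hw]

variable {I : Type*} {U : Ultrafilter I}

/-- A family of points of the sphere that converges along an ultrafilter has convergent
homogeneous coordinates. -/
theorem exists_tendsto_homogeneous {x : I → Sphere} {y : Sphere}
    (hx : Tendsto x U (𝓝 y)) : ∃ (v : I → Fin 2 → ℂ) (w : Fin 2 → ℂ), (∀ i, v i ≠ 0) ∧ w ≠ 0 ∧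
      (∀ i, ofHomogeneous (v i) = x i) ∧ ofHomogeneous w = y ∧ Tendsto v U (𝓝 w) := by
  choose v hv1 hv using fun i => exists_ofHomogeneous_eq (x i)
  have hne : ∀ {v : Fin 2 → ℂ}, ‖v‖ = 1 → v ≠ 0 := fun h h' => by simp [h'] at h
  obtain ⟨w, hw, hlim⟩ := (isCompact_sphere (0 : Fin 2 → ℂ) 1).ultrafilter_le_nhds
    (U.map v) (by
      simp only [le_principal_iff, Ultrafilter.mem_coe, Ultrafilter.mem_map]
      exact Filter.univ_mem' fun i => by simp [hv1])
  have hw1 : ‖w‖ = 1 := by simpa using hw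
  refine ⟨v, w, fun i => hne (hv1 i), hne hw1, hv, ?_, hlim⟩
  have h1 := (continuousAt_ofHomogeneous (hne hw1)).tendsto.comp (show Tendsto v U (𝓝 w) from hlim)
  simp only [Function.comp_def, hv] at h1
  exact tendsto_nhds_unique h1 hx

theorem tendsto_mulVec {l : Filter I} {N : I → Matrix (Fin 2) (Fin 2) ℂ}
    {M : Matrix (Fin 2) (Fin 2) ℂ} {v : I → Fin 2 → ℂ} {w : Fin 2 → ℂ}
    (hN : Tendsto N l (𝓝 M)) (hv : Tendsto v l (𝓝 w)) :
    Tendsto (fun i => (N i).mulVec (v i)) l (𝓝 (M.mulVec w)) := by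
  have h1 : ∀ a b, Tendsto (fun i => N i a b) l (𝓝 (M a b)) := fun a b =>
    tendsto_pi_nhds.1 (tendsto_pi_nhds.1 hN a) b
  have h2 := tendsto_pi_nhds.1 hv
  refine tendsto_pi_nhds.2 fun a => ?_
  simp only [Matrix.mulVec, dotProduct, Fin.sum_univ_two]
  exact ((h1 a 0).mul (h2 0)).add ((h1 a 1).mul (h2 1))

/-- The limit matrix `M` may be singular: only its effect on the homogeneous coordinates of the
limit point matters, provided that it does not kill them. -/
theorem tendsto_smul_of_tendsto {A : I → GL (Fin 2) ℂ} {c : I → ℂ} {M : Matrix (Fin 2) (Fin 2) ℂ}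
    (hc : ∀ i, c i ≠ 0) (hA : Tendsto (fun i => c i • (A i).val) U (𝓝 M)) {x : I → Sphere}
    {y z : Sphere} (hx : Tendsto x U (𝓝 y))
    (hM : ∀ v : Fin 2 → ℂ, v ≠ 0 → ofHomogeneous v = y →
      M.mulVec v ≠ 0 ∧ ofHomogeneous (M.mulVec v) = z) :
    Tendsto (fun i => A i • x i) U (𝓝 z) := by
  obtain ⟨v, w, hv, hw, hvx, hwy, hlim⟩ := exists_tendsto_homogeneous hx
  obtain ⟨h1, h2⟩ := hM w hw hwy
  have h3 : Tendsto (fun i => (c i • (A i).val).mulVec (v i)) U (𝓝 (M.mulVec w)) :=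
    tendsto_mulVec hA hlim
  have h4 := (continuousAt_ofHomogeneous h1).tendsto.comp h3
  rw [h2] at h4
  refine h4.congr fun i => ?_
  rw [Function.comp_apply, Matrix.smul_mulVec, ofHomogeneous_smul (hc i),
    ← smul_ofHomogeneous _ (hv i), hvx]

theorem mulVec_ne_zero (A : GL (Fin 2) ℂ) {v : Fin 2 → ℂ} (hv : v ≠ 0) :
    A.val.mulVec v ≠ 0 := fun h => hv <| by
  have : (A⁻¹).val.mulVec (A.val.mulVec v) = v := by
    rw [Matrix.mulVec_mulVec, ← Units.val_mul, inv_mul_cancel, Units.val_one, Matrix.one_mulVec]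
  rw [← this, h, Matrix.mulVec_zero]

theorem continuous_smul_GL (A : GL (Fin 2) ℂ) : Continuous fun x : Sphere => A • x := by
  refine continuous_iff_ultrafilter.2 fun x U hU => ?_
  refine tendsto_smul_of_tendsto (U := U) (A := fun _ => A) (c := fun _ => 1) (x := id)
    (M := A.val) (fun _ => one_ne_zero) (by simp only [one_smul]; exact tendsto_const_nhds) hU fun v hv hvx => ?_
  exact ⟨mulVec_ne_zero A hv, by rw [← smul_ofHomogeneous A hv, hvx]⟩

theorem continuous_smul_PGL (γ : PGL(2, ℂ)) : Continuous fun x : Sphere => γ • x := by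
  obtain ⟨A, rfl⟩ := QuotientGroup.mk_surjective γ
  exact continuous_smul_GL A

/-- A family of invertible matrices can be rescaled so that it has a nonzero limit along a given
ultrafilter. -/
theorem exists_tendsto_smul_matrix (U : Ultrafilter I) (A : I → GL (Fin 2) ℂ) :
    ∃ (c : I → ℂ) (M : Matrix (Fin 2) (Fin 2) ℂ), (∀ i, c i ≠ 0) ∧ M ≠ 0 ∧
      Tendsto (fun i => c i • (A i).val) U (𝓝 M) := by
  let N : I → Fin 2 → Fin 2 → ℂ := fun i a b => (A i).val a b
  have hN : ∀ i, N i ≠ 0 := fun i h => (A i).ne_zero (by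
    ext a b
    exact congrFun (congrFun h a) b)
  let c : I → ℂ := fun i => ((‖N i‖⁻¹ : ℝ) : ℂ)
  obtain ⟨M, hM, hlim⟩ := (isCompact_sphere (0 : Fin 2 → Fin 2 → ℂ) 1).ultrafilter_le_nhds
    (U.map fun i => c i • N i) (by
      simp only [le_principal_iff, Ultrafilter.mem_coe, Ultrafilter.mem_map]
      refine Filter.univ_mem' fun i => ?_
      have := hN i
      simp [c, norm_smul, this])
  refine ⟨c, M, fun i => by simpa [c] using hN i, fun h => ?_, hlim⟩
  have : (M : Fin 2 → Fin 2 → ℂ) = 0 := h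
  simp [this] at hM

theorem exists_eq_vecMulVec {M : Matrix (Fin 2) (Fin 2) ℂ} (hM : M ≠ 0) (hdet : M.det = 0) :
    ∃ a l : Fin 2 → ℂ, a ≠ 0 ∧ l ≠ 0 ∧ M = Matrix.vecMulVec a l := by
  obtain ⟨i, j, hij⟩ : ∃ i j, M i j ≠ 0 := by
    by_contra! h
    exact hM (Matrix.ext h)
  -- Through a nonzero entry `(i, j)`: column `j`, and row `i` divided by that entry.
  refine ⟨fun k => M k j, fun k => M i k / M i j, fun h => hij (congrFun h i),
    fun h => by simpa [hij] using congrFun h j, Matrix.ext fun k m => ?_⟩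
  rw [Matrix.vecMulVec_apply, ← mul_div_assoc, eq_div_iff hij]
  rw [Matrix.det_fin_two] at hdet
  fin_cases i <;> fin_cases j <;> fin_cases k <;> fin_cases m <;> simp <;> grind

/-- The vector `![l 1, -l 0]` spans the kernel of `l`; every vector off this line is sent to a
nonzero multiple of `a`. -/
theorem ofHomogeneous_vecMulVec {a l v : Fin 2 → ℂ} (ha : a ≠ 0) (hl : l ≠ 0) (hv : v ≠ 0)
    (h : ofHomogeneous v ≠ ofHomogeneous ![l 1, -l 0]) :
    (Matrix.vecMulVec a l).mulVec v ≠ 0 ∧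
      ofHomogeneous ((Matrix.vecMulVec a l).mulVec v) = ofHomogeneous a := by
  have hl' : ![l 1, -l 0] ≠ 0 := fun h => hl (funext fun i => by
    have h0 := congrFun h 0
    have h1 := congrFun h 1
    fin_cases i <;> simp_all)
  rw [Ne, ofHomogeneous_eq_iff hv hl'] at h
  have hne : l 0 * v 0 + l 1 * v 1 ≠ 0 := fun h0 => h (by simp; linear_combination -h0)
  have e : (Matrix.vecMulVec a l).mulVec v = (l 0 * v 0 + l 1 * v 1) • a := by
    ext i
    fin_cases i <;> simp [Matrix.vecMulVec_apply] <;> ring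
  rw [e]
  exact ⟨smul_ne_zero hne ha, ofHomogeneous_smul hne a⟩

/-- A family of Möbius transformations, restricted to an ultrafilter, either converges to a
Möbius transformation, or converges to a constant locally uniformly outside one point. -/
theorem convergence_dichotomy (U : Ultrafilter I) (A : I → GL (Fin 2) ℂ) :
    (∃ T : GL (Fin 2) ℂ, ∀ x : Sphere, Tendsto (fun i => (A i)⁻¹ • T • x) U (𝓝 x)) ∨
    ∃ a b : Sphere,
      (∀ (x : I → Sphere) (y : Sphere), Tendsto x U (𝓝 y) → y ≠ b →
        Tendsto (fun i => A i • x i) U (𝓝 a)) ∧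
      ∀ (x : I → Sphere) (y : Sphere), Tendsto x U (𝓝 y) → y ≠ a →
        Tendsto (fun i => (A i)⁻¹ • x i) U (𝓝 b) := by
  obtain ⟨c, M, hc, hM, hlim⟩ := exists_tendsto_smul_matrix U A
  -- The adjugate is a multiple of the inverse and is polynomial in the entries, so the rescaled
  -- inverses converge even if `M` is singular.
  have hinv : Tendsto (fun i => (c i * (A i).val.det) • ((A i)⁻¹).val) U (𝓝 M.adjugate) := by
    have h1 : Tendsto (fun i => (c i • (A i).val).adjugate) U (𝓝 M.adjugate) :=
      (continuous_id.matrix_adjugate.tendsto M).comp hlim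
    refine h1.congr fun i => ?_
    have hdet : (A i).val.det ≠ 0 := (A i).det_ne_zero
    rw [Matrix.adjugate_smul, Matrix.coe_units_inv, Matrix.inv_def, smul_smul]
    simp [hdet]
  have hc' : ∀ i, c i * (A i).val.det ≠ 0 := fun i => mul_ne_zero (hc i) (A i).det_ne_zero
  by_cases hdet : M.det = 0
  · right
    obtain ⟨a, l, ha, hl, rfl⟩ := exists_eq_vecMulVec hM hdet
    refine ⟨ofHomogeneous a, ofHomogeneous ![l 1, -l 0], fun x y hx hy => ?_, fun x y hx hy => ?_⟩
    · exact tendsto_smul_of_tendsto hc hlim hx fun v hv hvy =>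
        ofHomogeneous_vecMulVec ha hl hv (hvy ▸ hy)
    -- Passing to the adjugate of a rank one matrix exchanges its kernel and image, hence the
    -- repelling and attracting points.
    · have e : (Matrix.vecMulVec a l).adjugate = Matrix.vecMulVec ![l 1, -l 0] ![a 1, -a 0] := by
        rw [Matrix.adjugate_fin_two]
        ext i j
        fin_cases i <;> fin_cases j <;> simp [Matrix.vecMulVec_apply] <;> ring
      rw [e] at hinv
      have hrot : ∀ {a : Fin 2 → ℂ}, a ≠ 0 → ![a 1, -a 0] ≠ 0 := fun ha h =>
        ha (funext fun i => by
          have h0 := congrFun h 0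
          have h1 := congrFun h 1
          fin_cases i <;> simp_all)
      refine tendsto_smul_of_tendsto hc' hinv hx fun v hv hvy =>
        ofHomogeneous_vecMulVec (hrot hl) (hrot ha) hv ?_
      rw [hvy]
      convert hy using 1
      rw [← ofHomogeneous_smul (neg_ne_zero.2 one_ne_zero) a]
      congr 1
      ext i
      fin_cases i <;> simp
  · left
    let T : GL (Fin 2) ℂ := Matrix.GeneralLinearGroup.mkOfDetNeZero M hdet
    refine ⟨T, fun x => tendsto_smul_of_tendsto hc' hinv tendsto_const_nhds fun v hv hvx => ?_⟩
    obtain ⟨w, hw, rfl⟩ := exists_ofHomogeneous_eq x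
    have hw0 : w ≠ 0 := fun h => by simp [h] at hw
    rw [smul_ofHomogeneous T hw0, eq_comm] at hvx
    have e : M.adjugate = M.det • (T⁻¹).val := by
      rw [Matrix.coe_units_inv, Matrix.inv_def, smul_smul]
      change _ = (M.det * Ring.inverse M.det) • M.adjugate
      simp [hdet]
    rw [e, Matrix.smul_mulVec]
    refine ⟨smul_ne_zero hdet (mulVec_ne_zero _ hv), ?_⟩
    rw [ofHomogeneous_smul hdet, ← smul_ofHomogeneous _ hv, ← hvx, ← smul_ofHomogeneous T hw0,
      inv_smul_smul]

/-- Needed to replace ultrafilter limits by the sequences in the definition of `limitSet`. -/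
instance : FirstCountableTopology Sphere := ⟨fun x => by
  induction x using OnePoint.rec with
  | infty =>
    rw [OnePoint.nhds_infty_eq, Filter.coclosedCompact_eq_cocompact,
      ← Metric.cobounded_eq_cocompact, ← comap_norm_atTop, ← principal_singleton]
    infer_instance
  | coe z => rw [OnePoint.nhds_coe_eq]; infer_instance⟩

end Moebius

end Schottky

/-! ### Ping-pong dynamics of Schottky groups. -/

namespace Schottky

section PingPong

variable {g : ℕ}

/-- The inverse of a letter. -/
def letterInv (s : Fin g × Bool) : Fin g × Bool := (s.1, !s.2)

theorem mk_letterInv (s : Fin g × Bool) :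
    FreeGroup.mk [letterInv s] = (FreeGroup.mk [s])⁻¹ := by
  simp [FreeGroup.inv_mk, FreeGroup.invRev, letterInv]

theorem ne_letterInv_iff {s t : Fin g × Bool} :
    t ≠ letterInv s ↔ (s.1 = t.1 → s.2 = t.2) := by
  obtain ⟨i, a⟩ := s
  obtain ⟨j, b⟩ := t
  simp only [letterInv, ne_eq, Prod.mk.injEq]
  cases a <;> cases b <;> simp [eq_comm]

/-- The family of discs `D` is in ping-pong position for the generators of a free group acting on
the sphere by means of `σ`. -/
structure IsPingPong (σ : FreeGroup (Fin g) →* PGL(2, ℂ)) (D : Fin g × Bool → Set Sphere) :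
    Prop where
  isClosed : ∀ s, IsClosed (D s)
  nonempty : ∀ s, (D s).Nonempty
  disjoint : Pairwise fun s t => Disjoint (D s) (D t)
  smul_mem : ∀ s, ∀ x ∉ D (letterInv s), σ (FreeGroup.mk [s]) • x ∈ D s

/-- The exterior of the discs. -/
def exterior (D : Fin g × Bool → Set Sphere) : Set Sphere := (⋃ s, D s)ᶜ

theorem notMem_of_mem_exterior {D : Fin g × Bool → Set Sphere} {x : Sphere} (hx : x ∈ exterior D)
    (s : Fin g × Bool) : x ∉ D s := fun h => hx (Set.mem_iUnion.2 ⟨s, h⟩)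

/-- For an inverse generator, if `γ⁻¹ x` lay outside `D (i, false)`, then `x = γ (γ⁻¹ x)` would lie
in the interior of `D (i, true)`. -/
theorem exists_isPingPong {Γ : Subgroup PGL(2, ℂ)} (hΓ : IsSchottkyGroup g Γ) :
    ∃ (σ : FreeGroup (Fin g) →* PGL(2, ℂ)) (D : Fin g × Bool → Set Sphere),
      IsPingPong σ D ∧ σ.range = Γ := by
  obtain ⟨γ, D, hball, hdisj, hmap, rfl⟩ := hΓ
  have hlift : ∀ i b, FreeGroup.lift γ (FreeGroup.mk [(i, b)]) = cond b (γ i) (γ i)⁻¹ := by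
    intro i b
    rw [FreeGroup.lift_mk]
    simp
  refine ⟨FreeGroup.lift γ, D, ⟨fun s => ?_, fun s => ?_, hdisj, ?_⟩, FreeGroup.range_lift_eq_closure⟩
  · obtain ⟨e⟩ := hball s
    have : CompactSpace (Metric.closedBall (0 : ℂ) 1) :=
      isCompact_iff_compactSpace.1 (isCompact_closedBall _ _)
    have : CompactSpace (D s) := e.symm.compactSpace
    exact (isCompact_iff_compactSpace.2 this).isClosed
  · obtain ⟨e⟩ := hball s
    exact ⟨_, (e.symm ⟨0, by simp⟩).2⟩
  · rintro ⟨i, b⟩ x hx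
    rw [hlift]
    cases b with
    | true =>
      exact interior_subset (hmap i ▸ Set.mem_image_of_mem (fun x => γ i • x) hx)
    | false =>
      by_contra h
      have h1 := hmap i ▸ Set.mem_image_of_mem (fun x => γ i • x) (Set.mem_compl h)
      simp only [cond_false, smul_inv_smul] at h1
      exact hx (interior_subset h1)

namespace IsPingPong

variable {σ : FreeGroup (Fin g) →* PGL(2, ℂ)} {D : Fin g × Bool → Set Sphere}

theorem isOpen_exterior (h : IsPingPong σ D) : IsOpen (exterior D) :=
  (isClosed_iUnion_of_finite h.isClosed).isOpen_compl

/-- If the discs covered the sphere, each would be the complement of a finite union of closed sets,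
hence clopen, contradicting connectedness. -/
theorem nonempty_exterior (h : IsPingPong σ D) (hg : g ≠ 0) : (exterior D).Nonempty := by
  by_contra! hempty
  have : NeZero g := ⟨hg⟩
  set s₀ : Fin g × Bool := (0, true)
  have hcover : ⋃ s, D s = Set.univ := by
    rw [exterior, Set.compl_empty_iff] at hempty
    exact hempty
  have hcompl : (D s₀)ᶜ = ⋃ s : {s // s ≠ s₀}, D s := by
    ext x
    constructor
    · intro hx
      obtain ⟨s, hs⟩ := Set.mem_iUnion.1 (hcover ▸ Set.mem_univ x)
      exact Set.mem_iUnion.2 ⟨⟨s, fun e => hx (e ▸ hs)⟩, hs⟩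
    · intro hx hx0
      obtain ⟨s, hs⟩ := Set.mem_iUnion.1 hx
      exact Set.disjoint_left.1 (h.disjoint s.2) hs hx0
  have hclopen : IsClopen (D s₀) := by
    refine ⟨h.isClosed _, ?_⟩
    rw [← isClosed_compl_iff, hcompl]
    exact isClosed_iUnion_of_finite fun s => h.isClosed s
  have huniv := hclopen.eq_univ (h.nonempty _)
  obtain ⟨x, hx⟩ := h.nonempty ((0, false) : Fin g × Bool)
  exact Set.disjoint_left.1 (h.disjoint (i := (0, false)) (j := s₀) (by simp [s₀])) hx
    (huniv ▸ Set.mem_univ x)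

theorem exists_mem_exterior_ne (h : IsPingPong σ D) (hg : g ≠ 0) (b : Sphere) :
    ∃ y ∈ exterior D, y ≠ b := by
  obtain ⟨x, hx⟩ := h.nonempty_exterior hg
  rcases eq_or_ne x b with rfl | hne
  · have h1 : ∀ᶠ y in 𝓝[≠] x, y ∈ exterior D :=
      nhdsWithin_le_nhds (h.isOpen_exterior.mem_nhds hx)
    obtain ⟨y, hy, hy'⟩ := (h1.and self_mem_nhdsWithin).exists
    exact ⟨y, hy, hy'⟩
  · exact ⟨x, hx, hne⟩

/-- The nested discs indexed by words. -/
def nest (σ : FreeGroup (Fin g) →* PGL(2, ℂ)) (D : Fin g × Bool → Set Sphere) :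
    List (Fin g × Bool) → Set Sphere
  | [] => Set.univ
  | s :: L => {x | x ∈ D s ∧ (σ (FreeGroup.mk [s]))⁻¹ • x ∈ nest σ D L}

theorem isClosed_nest (h : IsPingPong σ D) (L : List (Fin g × Bool)) : IsClosed (nest σ D L) := by
  induction L with
  | nil => exact isClosed_univ
  | cons s L ih => exact (h.isClosed s).inter (ih.preimage (continuous_smul_PGL _))

theorem eq_of_mem_nest (h : IsPingPong σ D) {L L' : List (Fin g × Bool)}
    (hlen : L.length = L'.length) {x : Sphere} (hx : x ∈ nest σ D L) (hx' : x ∈ nest σ D L') :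
    L = L' := by
  induction L generalizing L' x with
  | nil => exact (List.length_eq_zero_iff.1 hlen.symm).symm
  | cons s L ih =>
    obtain _ | ⟨s', L'⟩ := L'
    · simp at hlen
    · have hs : s = s' := by
        by_contra hne
        exact Set.disjoint_left.1 (h.disjoint hne) hx.1 hx'.1
      subst hs
      rw [ih (by simpa using hlen) hx.2 hx'.2]

theorem nest_append_subset {σ : FreeGroup (Fin g) →* PGL(2, ℂ)} {D : Fin g × Bool → Set Sphere}
    {L L' : List (Fin g × Bool)} {x : Sphere} (hx : x ∈ nest σ D (L ++ L')) :
    x ∈ nest σ D L := by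
  induction L generalizing x with
  | nil => trivial
  | cons s L ih => exact ⟨hx.1, ih hx.2⟩

theorem inv_smul_mem_of_mem_nest {σ : FreeGroup (Fin g) →* PGL(2, ℂ)}
    {D : Fin g × Bool → Set Sphere} {L : List (Fin g × Bool)} {s : Fin g × Bool} {x : Sphere}
    (hx : x ∈ nest σ D (L ++ [s])) : (σ (FreeGroup.mk L))⁻¹ • x ∈ D s := by
  induction L generalizing x with
  | nil =>
    rw [← FreeGroup.one_eq_mk, map_one, inv_one, one_smul]
    exact hx.1
  | cons t L ih =>
    have h1 : FreeGroup.mk (t :: L) = FreeGroup.mk [t] * FreeGroup.mk L := by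
      rw [FreeGroup.mul_mk]; rfl
    rw [h1, map_mul, mul_inv_rev, mul_smul]
    exact ih hx.2

theorem smul_mem_nest (h : IsPingPong σ D) {y : Sphere} (hy : y ∈ exterior D)
    {L : List (Fin g × Bool)} (hL : FreeGroup.IsReduced L) :
    σ (FreeGroup.mk L) • y ∈ nest σ D L := by
  induction L with
  | nil => trivial
  | cons s L ih =>
    have hL' : FreeGroup.IsReduced L := hL.infix ⟨[s], [], by simp⟩
    have h1 : FreeGroup.mk (s :: L) = FreeGroup.mk [s] * FreeGroup.mk L := by
      rw [FreeGroup.mul_mk]; rfl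
    rw [h1, map_mul, mul_smul]
    refine ⟨h.smul_mem s _ fun hmem => ?_, by rw [inv_smul_smul]; exact ih hL'⟩
    cases L with
    | nil =>
      rw [← FreeGroup.one_eq_mk, map_one, one_smul] at hmem
      exact notMem_of_mem_exterior hy _ hmem
    | cons t L =>
      have hne : t ≠ letterInv s := ne_letterInv_iff.2 (FreeGroup.isReduced_cons_cons.1 hL).1
      exact Set.disjoint_left.1 (h.disjoint hne) (ih hL').1 hmem

theorem smul_mem_nest_wordPrefix (h : IsPingPong σ D) {y : Sphere} (hy : y ∈ exterior D)
    (u : FreeGroup (Fin g)) (k : ℕ) : σ u • y ∈ nest σ D (wordPrefix k u) := by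
  have h1 := h.smul_mem_nest hy (FreeGroup.isReduced_toWord (x := u))
  rw [FreeGroup.mk_toWord, ← List.take_append_drop k u.toWord] at h1
  exact nest_append_subset h1

theorem smul_notMem_exterior (h : IsPingPong σ D) {y : Sphere} (hy : y ∈ exterior D)
    {u : FreeGroup (Fin g)} (hu : u ≠ 1) : σ u • y ∉ exterior D := by
  have h1 := h.smul_mem_nest hy (FreeGroup.isReduced_toWord (x := u))
  rw [FreeGroup.mk_toWord] at h1
  cases h2 : u.toWord with
  | nil => exact absurd (FreeGroup.toWord_eq_nil_iff.1 h2) hu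
  | cons s L =>
    rw [h2] at h1
    exact fun hmem => notMem_of_mem_exterior hmem s h1.1

theorem injective (h : IsPingPong σ D) (hg : g ≠ 0) : Function.Injective σ := by
  refine (injective_iff_map_eq_one σ).2 fun u hu => ?_
  by_contra hne
  obtain ⟨y, hy⟩ := h.nonempty_exterior hg
  exact h.smul_notMem_exterior hy hne (by rwa [hu, one_smul])

/-- The group acts on the sphere as a convergence group. -/
theorem exists_attracting_repelling (h : IsPingPong σ D) (hg : g ≠ 0)
    {U : Ultrafilter (FreeGroup (Fin g))} (hU : (U : Filter (FreeGroup (Fin g))) ≤ cofinite) :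
    ∃ a b : Sphere,
      (∀ (x : FreeGroup (Fin g) → Sphere) (y : Sphere), Tendsto x U (𝓝 y) → y ≠ b →
        Tendsto (fun u => σ u • x u) U (𝓝 a)) ∧
      ∀ (x : FreeGroup (Fin g) → Sphere) (y : Sphere), Tendsto x U (𝓝 y) → y ≠ a →
        Tendsto (fun u => (σ u)⁻¹ • x u) U (𝓝 b) := by
  choose A hA using fun u => Matrix.ProjGenLinGroup.mk_surjective (σ u)
  have hsmul : ∀ u (x : Sphere), A u • x = σ u • x := fun u x => by rw [← hA]; rfl
  have hsmul' : ∀ u (x : Sphere), (A u)⁻¹ • x = (σ u)⁻¹ • x := fun u x => by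
    rw [← hA, ← map_inv]; rfl
  rcases convergence_dichotomy U A with ⟨T, hT⟩ | hab
  · exfalso
    obtain ⟨y, hy⟩ := h.nonempty_exterior hg
    -- For an invertible limit `T`, the points `σ(u)⁻¹ T y` would lie in the exterior for almost all
    -- `u`. Since nontrivial elements move the exterior off itself, this holds for at most one `u`.
    have h1 : {u | (A u)⁻¹ • T • y ∈ exterior D} ∈ (U : Filter (FreeGroup (Fin g))) :=
      (hT y) (h.isOpen_exterior.mem_nhds hy)
    have h2 : {u | (A u)⁻¹ • T • y ∈ exterior D}.Subsingleton := by
      intro u hu v hv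
      by_contra hne
      have h3 : v⁻¹ * u ≠ 1 := fun e => hne (inv_mul_eq_one.1 e).symm
      refine h.smul_notMem_exterior hu h3 ?_
      rw [Set.mem_ofPred_eq, hsmul'] at hv
      rwa [hsmul', map_mul, map_inv, mul_smul, smul_inv_smul]
    have h3 := U.neBot
    have h4 := (h2.finite.compl_mem_cofinite)
    obtain ⟨u, hu, hu'⟩ := (Filter.inter_mem h1 (hU h4) |> Filter.nonempty_of_mem)
    exact hu' hu
  · simpa only [hsmul, hsmul'] using hab

variable {U : Ultrafilter (FreeGroup (Fin g))}

theorem tendsto_inv_cofinite :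
    Tendsto (fun u : FreeGroup (Fin g) => u⁻¹) cofinite cofinite :=
  inv_injective.tendsto_cofinite

/-- The ultrafilter lies below a countably generated filter that records both the growth of the norm
and the convergence; a sequence along that filter, thinned to strictly increasing norms, consists of
distinct group elements. -/
theorem mem_limitSet_of_tendsto (h : IsPingPong σ D) (hg : g ≠ 0)
    (hU : (U : Filter (FreeGroup (Fin g))) ≤ cofinite) {x z : Sphere}
    (hx : Tendsto (fun u => σ u • z) U (𝓝 x)) : x ∈ limitSet σ.range := by
  set l : Filter (FreeGroup (Fin g)) :=
    comap FreeGroup.norm atTop ⊓ comap (fun u => σ u • z) (𝓝 x) with hl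
  have hUl : (U : Filter (FreeGroup (Fin g))) ≤ l :=
    le_inf (tendsto_norm_cofinite.mono_left hU).le_comap hx.le_comap
  have : l.NeBot := U.neBot.mono hUl
  obtain ⟨u, hu⟩ := exists_seq_tendsto l
  have hu1 : Tendsto (fun n => (u n).norm) atTop atTop :=
    (tendsto_comap_iff (g := FreeGroup.norm)).1 (hu.mono_right inf_le_left)
  have hu2 : Tendsto (fun n => σ (u n) • z) atTop (𝓝 x) :=
    tendsto_comap_iff.1 (hu.mono_right inf_le_right)
  obtain ⟨φ, hφ, hφ'⟩ := strictMono_subseq_of_tendsto_atTop hu1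
  refine subset_closure ⟨z, fun n => ⟨σ (u (φ n)), u (φ n), rfl⟩, fun m n hmn => ?_,
    hu2.comp hφ.tendsto_atTop⟩
  refine hφ'.injective ?_
  exact congrArg FreeGroup.norm (h.injective hg (congrArg Subtype.val hmn))

theorem mem_limitSet_of_tendsto_inv (h : IsPingPong σ D) (hg : g ≠ 0)
    (hU : (U : Filter (FreeGroup (Fin g))) ≤ cofinite) {x z : Sphere}
    (hx : Tendsto (fun u => (σ u)⁻¹ • z) U (𝓝 x)) : x ∈ limitSet σ.range := by
  refine h.mem_limitSet_of_tendsto (U := U.map fun u => u⁻¹) hg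
    (tendsto_inv_cofinite.mono_left hU) (z := z) ?_
  rw [Ultrafilter.coe_map, tendsto_map'_iff]
  simpa only [Function.comp_def, map_inv] using hx

/-- The attracting and the repelling point of a sequence in the group belong to the
limit set. -/
theorem attracting_mem_limitSet (h : IsPingPong σ D) (hg : g ≠ 0)
    (hU : (U : Filter (FreeGroup (Fin g))) ≤ cofinite) {a b : Sphere}
    (ha : ∀ (x : FreeGroup (Fin g) → Sphere) (y : Sphere), Tendsto x U (𝓝 y) → y ≠ b →
        Tendsto (fun u => σ u • x u) U (𝓝 a)) : a ∈ limitSet σ.range := by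
  obtain ⟨y, -, hyb⟩ := h.exists_mem_exterior_ne hg b
  exact h.mem_limitSet_of_tendsto hg hU (ha _ y tendsto_const_nhds hyb)

theorem repelling_mem_limitSet (h : IsPingPong σ D) (hg : g ≠ 0)
    (hU : (U : Filter (FreeGroup (Fin g))) ≤ cofinite) {a b : Sphere}
    (hb : ∀ (x : FreeGroup (Fin g) → Sphere) (y : Sphere), Tendsto x U (𝓝 y) → y ≠ a →
        Tendsto (fun u => (σ u)⁻¹ • x u) U (𝓝 b)) : b ∈ limitSet σ.range := by
  obtain ⟨y, -, hya⟩ := h.exists_mem_exterior_ne hg a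
  exact h.mem_limitSet_of_tendsto_inv hg hU (hb _ y tendsto_const_nhds hya)

theorem inv_smul_initialWord_mem (h : IsPingPong σ D) {y : Sphere} (hy : y ∈ exterior D)
    {η : ℕ → Fin g × Bool} (hη : IsInfiniteReducedWord η) (k : ℕ) :
    (σ (initialWord η (k + 1)))⁻¹ • y ∈ D (letterInv (η k)) := by
  have hword : ∀ k, (σ (initialWord η (k + 1)))⁻¹ • y =
      σ (FreeGroup.mk [letterInv (η k)]) • (σ (initialWord η k))⁻¹ • y := by
    intro k
    have h1 : initialWord η (k + 1) = initialWord η k * FreeGroup.mk [η k] := by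
      change FreeGroup.mk (initialList η (k + 1)) = FreeGroup.mk (initialList η k) * _
      rw [initialList_succ, FreeGroup.mul_mk]
    rw [h1, map_mul, mul_inv_rev, mul_smul, mk_letterInv, map_inv]
  have hinv : ∀ s : Fin g × Bool, letterInv (letterInv s) = s := fun s => by simp [letterInv]
  induction k with
  | zero =>
    rw [hword]
    refine h.smul_mem _ _ ?_
    have h1 : initialWord η 0 = 1 := rfl
    rw [h1, map_one, inv_one, one_smul]
    exact notMem_of_mem_exterior hy _
  | succ k ih =>
    rw [hword]
    refine h.smul_mem _ _ fun hmem => ?_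
    rw [hinv] at hmem
    exact Set.disjoint_left.1 (h.disjoint (ne_letterInv_iff.2 (hη k))) hmem ih

/-- The nested discs along an infinite reduced word shrink to a point. -/
theorem eq_of_mem_nest_initialList (h : IsPingPong σ D) (hg : g ≠ 0) {η : ℕ → Fin g × Bool}
    (hη : IsInfiniteReducedWord η) {x x' : Sphere} (hx : ∀ k, x ∈ nest σ D (initialList η k))
    (hx' : ∀ k, x' ∈ nest σ D (initialList η k)) : x = x' := by
  set W : Ultrafilter ℕ := hyperfilter ℕ
  set η' : ℕ → FreeGroup (Fin g) := fun k => initialWord η (k + 1)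
  have hη' : Tendsto η' W cofinite :=
    ((tendsto_initialWord hη).comp (tendsto_add_atTop_nat 1)).mono_left Nat.hyperfilter_le_atTop
  obtain ⟨a, b, ha, hb⟩ := h.exists_attracting_repelling hg (U := W.map η') hη'
  -- By finiteness of the alphabet, the next letter `s` and the inverse `t` of the last letter are
  -- constant along the ultrafilter; they differ because the word is reduced. Pulled back by the
  -- initial words, a point of the nest lands in `D s`, while the repelling point lies in `D t`.
  obtain ⟨s, hs⟩ : ∃ s, ∀ᶠ k in (W : Filter ℕ), η (k + 1) = s := by
    rw [← Ultrafilter.eventually_exists_iff]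
    exact Eventually.of_forall fun k => ⟨_, rfl⟩
  obtain ⟨t, ht⟩ : ∃ t, ∀ᶠ k in (W : Filter ℕ), letterInv (η k) = t := by
    rw [← Ultrafilter.eventually_exists_iff]
    exact Eventually.of_forall fun k => ⟨_, rfl⟩
  have hst : s ≠ t := by
    obtain ⟨k, h1, h2⟩ := (hs.and ht).exists
    rw [← h1, ← h2]
    exact ne_letterInv_iff.2 (hη k)
  obtain ⟨y, hy, hya⟩ := h.exists_mem_exterior_ne hg a
  have hbt : b ∈ D t := by
    have h1 := hb _ y tendsto_const_nhds hya
    rw [Ultrafilter.coe_map, tendsto_map'_iff] at h1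
    refine (h.isClosed t).mem_of_tendsto h1 ?_
    filter_upwards [ht] with k hk
    rw [← hk]
    exact h.inv_smul_initialWord_mem hy hη k
  have key : ∀ x, (∀ k, x ∈ nest σ D (initialList η k)) → x = a := by
    intro x hx
    obtain ⟨p, -, hp⟩ := isCompact_univ.ultrafilter_le_nhds
      ((W.map η').map fun u => (σ u)⁻¹ • x) (by simp)
    have hp' : Tendsto (fun u => (σ u)⁻¹ • x) (W.map η') (𝓝 p) := hp
    have hps : p ∈ D s := by
      have h1 := hp'
      rw [Ultrafilter.coe_map, tendsto_map'_iff] at h1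
      refine (h.isClosed s).mem_of_tendsto h1 ?_
      filter_upwards [hs] with k hk
      have h2 := hx (k + 2)
      rw [initialList_succ, hk] at h2
      exact inv_smul_mem_of_mem_nest h2
    have hpb : p ≠ b := fun e => Set.disjoint_left.1 (h.disjoint hst) hps (e ▸ hbt)
    -- Since the pulled-back points stay away from the repelling point, moving them forward again
    -- gives `a`; but this returns the constant `x`.
    have h3 := ha _ p hp' hpb
    simp only [smul_inv_smul] at h3
    exact tendsto_nhds_unique tendsto_const_nhds h3
  rw [key x hx, key x' hx']

/-- The base point `x₀` may lie inside the discs. Not being the repelling point, it has the same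
limit as a point `y` of the exterior, whose orbit follows the nested sets. -/
theorem tendsto_lim_mem_nest (h : IsPingPong σ D) (hg : g ≠ 0)
    (hU : (U : Filter (FreeGroup (Fin g))) ≤ cofinite) {η : ℕ → Fin g × Bool}
    (hUη : ∀ k, ∀ᶠ u in (U : Filter (FreeGroup (Fin g))), wordPrefix k u = initialList η k)
    {x₀ x : Sphere} (hx₀ : x₀ ∉ limitSet σ.range) (hx : Tendsto (fun u => σ u • x₀) U (𝓝 x))
    (k : ℕ) : x ∈ nest σ D (initialList η k) := by
  obtain ⟨a, b, ha, hb⟩ := h.exists_attracting_repelling hg hU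
  obtain ⟨y, hy, hyb⟩ := h.exists_mem_exterior_ne hg b
  have h1 := ha _ x₀ tendsto_const_nhds fun e =>
    hx₀ (e ▸ h.repelling_mem_limitSet hg hU hb)
  rw [tendsto_nhds_unique hx h1]
  refine (h.isClosed_nest _).mem_of_tendsto (ha _ y tendsto_const_nhds hyb) ?_
  filter_upwards [hUη k] with u hu
  rw [← hu]
  exact h.smul_mem_nest_wordPrefix hy u k

/-- Every point of the limit set is an accumulation point of the orbit of any given point outside
the limit set. -/
theorem exists_ultrafilter_tendsto (h : IsPingPong σ D) (hg : g ≠ 0) {x₀ x : Sphere}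
    (hx₀ : x₀ ∉ limitSet σ.range) (hx : x ∈ limitSet σ.range) :
    ∃ U : Ultrafilter (FreeGroup (Fin g)), (U : Filter (FreeGroup (Fin g))) ≤ cofinite ∧
      Tendsto (fun u => σ u • x₀) U (𝓝 x) := by
  suffices hmem : x ∈ {x | MapClusterPt x cofinite fun u => σ u • x₀} from
    mapClusterPt_iff_ultrafilter.1 hmem
  -- Cluster points form a closed set, which takes care of the closure in the definition of
  -- `limitSet`.
  have hclosed : IsClosed {x | MapClusterPt x cofinite fun u => σ u • x₀} := isClosed_setOfPred_clusterPt
  refine closure_minimal ?_ hclosed hx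
  rintro x ⟨z, γ, hγ, hlim⟩
  choose u hu using fun n => (γ n).2
  have hu' : Function.Injective u := fun m n hmn => hγ (Subtype.ext (by rw [← hu, ← hu, hmn]))
  have hV : Tendsto u (hyperfilter ℕ) cofinite :=
    hu'.tendsto_cofinite.mono_left hyperfilter_le_cofinite
  set V : Ultrafilter (FreeGroup (Fin g)) := (hyperfilter ℕ).map u
  have hVx : Tendsto (fun v => σ v • z) V (𝓝 x) := by
    rw [Ultrafilter.coe_map, tendsto_map'_iff]
    simp only [Function.comp_def, hu]
    exact hlim.mono_left Nat.hyperfilter_le_atTop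
  obtain ⟨a, b, ha, hb⟩ := h.exists_attracting_repelling hg (U := V) hV
  have hneb : x₀ ≠ b := fun e => hx₀ (e ▸ h.repelling_mem_limitSet (U := V) hg hV hb)
  have hnea : x₀ ≠ a := fun e => hx₀ (e ▸ h.attracting_mem_limitSet (U := V) hg hV ha)
  by_cases hzb : z = b
  -- The exceptional case: `z` is the repelling point. The inverses move `x₀` to `z`, so each `σ v •
  -- z` is a cluster point of the orbit of `x₀`, and `x` is a limit of such points.
  · subst hzb
    have hbL : Tendsto (fun w => σ w • x₀) (V.map fun u => u⁻¹) (𝓝 z) := by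
      rw [Ultrafilter.coe_map, tendsto_map'_iff]
      simpa only [Function.comp_def, map_inv] using hb _ x₀ tendsto_const_nhds hnea
    refine hclosed.mem_of_tendsto hVx (Eventually.of_forall fun v => ?_)
    refine mapClusterPt_iff_ultrafilter.2 ⟨(V.map fun u => u⁻¹).map fun w => v * w, ?_, ?_⟩
    · exact (mul_right_injective v).tendsto_cofinite.mono_left
        (tendsto_inv_cofinite.mono_left hV)
    · rw [Ultrafilter.coe_map (fun w => v * w), tendsto_map'_iff]
      simp only [Function.comp_def, map_mul, mul_smul]
      exact ((continuous_smul_PGL (σ v)).tendsto z).comp hbL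
  · rw [tendsto_nhds_unique hVx (ha _ z tendsto_const_nhds hzb)]
    exact mapClusterPt_iff_ultrafilter.2 ⟨V, hV, ha _ x₀ tendsto_const_nhds hneb⟩

end IsPingPong

end PingPong

end Schottky

/-! ### Coding of the limit set for an arbitrary marking. -/

namespace Schottky

section Coding

variable {g : ℕ}

/-- The limit set of the marked group `ρ` is homeomorphic to the space of infinite reduced words:
the words converge to points of the limit set, and this defines a continuous bijection. -/
structure IsBoundaryCoding (ρ : FreeGroup (Fin g) →* PGL(2, ℂ)) (x₀ : Sphere) : Prop where
  exists_lim : ∀ ξ, IsInfiniteReducedWord ξ → ∃ x ∈ limitSet ρ.range,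
    Tendsto (fun n => ρ (initialWord ξ n) • x₀) atTop (𝓝 x)
  injective : ∀ ξ ξ', IsInfiniteReducedWord ξ → IsInfiniteReducedWord ξ' → ∀ x,
    Tendsto (fun n => ρ (initialWord ξ n) • x₀) atTop (𝓝 x) →
    Tendsto (fun n => ρ (initialWord ξ' n) • x₀) atTop (𝓝 x) → ξ = ξ'
  surjective : ∀ x ∈ limitSet ρ.range, ∃ ξ, IsInfiniteReducedWord ξ ∧
    Tendsto (fun n => ρ (initialWord ξ n) • x₀) atTop (𝓝 x)
  continuous : ∀ ξ x, IsInfiniteReducedWord ξ →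
    Tendsto (fun n => ρ (initialWord ξ n) • x₀) atTop (𝓝 x) → ∀ O ∈ 𝓝 x, ∃ k, ∀ ζ y,
      IsInfiniteReducedWord ζ → (∀ i < k, ζ i = ξ i) →
      Tendsto (fun n => ρ (initialWord ζ n) • x₀) atTop (𝓝 y) → y ∈ O

/-- An automorphism of the free group maps infinite reduced words to infinite reduced words. -/
theorem exists_map_infiniteWord {α : FreeGroup (Fin g) →* FreeGroup (Fin g)}
    (hα : Function.Injective α) {ξ : ℕ → Fin g × Bool} (hξ : IsInfiniteReducedWord ξ) :
    ∃ η : ℕ → Fin g × Bool, IsInfiniteReducedWord η ∧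
      ∀ N, ∀ᶠ n in atTop, wordPrefix N (α (initialWord ξ n)) = initialList η N := by
  have h1 : Tendsto (fun n => α (initialWord ξ n)) atTop cofinite :=
    hα.tendsto_cofinite.comp (tendsto_initialWord hξ)
  obtain ⟨η, hη, hlim⟩ := exists_infiniteWord_of_ultrafilter
    (U := (hyperfilter ℕ).map fun n => α (initialWord ξ n))
    (h1.mono_left Nat.hyperfilter_le_atTop)
  refine ⟨η, hη, fun N => ?_⟩
  obtain ⟨k, hk⟩ := exists_wordPrefix_map_eq hα N
  have h2 : ∀ᶠ n in (hyperfilter ℕ : Filter ℕ),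
      wordPrefix N (α (initialWord ξ n)) = initialList η N := hlim N
  obtain ⟨m, hm, hm'⟩ := (h2.and
    (Nat.hyperfilter_le_atTop (eventually_ge_atTop k))).exists
  filter_upwards [eventually_ge_atTop k] with n hn
  rw [← hm]
  refine hk _ _ (by rwa [norm_initialWord hξ]) (by rwa [norm_initialWord hξ]) ?_
  rw [wordPrefix_initialWord hξ hn, wordPrefix_initialWord hξ hm']

variable {σ ρ : FreeGroup (Fin g) →* PGL(2, ℂ)} {D : Fin g × Bool → Set Sphere}
  {α : FreeGroup (Fin g) ≃* FreeGroup (Fin g)} {x₀ : Sphere}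

theorem IsPingPong.lim_mem_nest (h : IsPingPong σ D) (hg : g ≠ 0) (hρ : ∀ u, ρ u = σ (α u))
    (hx₀ : x₀ ∉ limitSet σ.range) {U : Ultrafilter ℕ} (hU : (U : Filter ℕ) ≤ atTop)
    {ξ η : ℕ → Fin g × Bool} (hξ : IsInfiniteReducedWord ξ)
    (hξη : ∀ N, ∀ᶠ n in atTop, wordPrefix N (α (initialWord ξ n)) = initialList η N) {x : Sphere}
    (hx : Tendsto (fun n => ρ (initialWord ξ n) • x₀) U (𝓝 x)) (N : ℕ) :
    x ∈ nest σ D (initialList η N) := by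
  refine h.tendsto_lim_mem_nest (U := U.map fun n => α (initialWord ξ n)) hg ?_
    (fun k => hU (hξη k)) hx₀ ?_ N
  · exact (α.injective.tendsto_cofinite.comp (tendsto_initialWord hξ)).mono_left hU
  · rw [Ultrafilter.coe_map, tendsto_map'_iff]
    simpa only [Function.comp_def, ← hρ] using hx

theorem IsPingPong.isBoundaryCoding (h : IsPingPong σ D) (hg : g ≠ 0)
    (hρ : ∀ u, ρ u = σ (α u)) (hx₀ : x₀ ∉ limitSet σ.range) : IsBoundaryCoding ρ x₀ := by
  have hα : Function.Injective (α : FreeGroup (Fin g) →* FreeGroup (Fin g)) := α.injective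
  have hα' : Function.Injective (α.symm : FreeGroup (Fin g) →* FreeGroup (Fin g)) :=
    α.symm.injective
  have hrange : ρ.range = σ.range := by
    ext γ
    constructor
    · rintro ⟨u, rfl⟩
      exact ⟨α u, (hρ u).symm⟩
    · rintro ⟨u, rfl⟩
      exact ⟨α.symm u, by rw [hρ, α.apply_symm_apply]⟩
  have hmem : ∀ {ξ η x}, IsInfiniteReducedWord ξ →
      (∀ N, ∀ᶠ n in atTop, wordPrefix N (α (initialWord ξ n)) = initialList η N) →
      Tendsto (fun n => ρ (initialWord ξ n) • x₀) atTop (𝓝 x) →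
      ∀ N, x ∈ nest σ D (initialList η N) := fun hξ hη hx N =>
    h.lim_mem_nest hg hρ hx₀ Nat.hyperfilter_le_atTop hξ hη
      (hx.mono_left Nat.hyperfilter_le_atTop) N
  have hlim : ∀ ξ, IsInfiniteReducedWord ξ → ∃ x ∈ limitSet ρ.range,
      Tendsto (fun n => ρ (initialWord ξ n) • x₀) atTop (𝓝 x) := by
    intro ξ hξ
    obtain ⟨η, hη, hξη⟩ := exists_map_infiniteWord hα hξ
    have hcpt : ∀ U : Ultrafilter ℕ, ∃ x,
        Tendsto (fun n => ρ (initialWord ξ n) • x₀) U (𝓝 x) := fun U => by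
      obtain ⟨x, -, hx⟩ := isCompact_univ.ultrafilter_le_nhds
        (U.map fun n => ρ (initialWord ξ n) • x₀) (by simp)
      exact ⟨x, hx⟩
    obtain ⟨x, hx⟩ := hcpt (hyperfilter ℕ)
    refine ⟨x, ?_, (tendsto_iff_ultrafilter _ _ _).2 fun U hU => ?_⟩
    · rw [hrange]
      refine h.mem_limitSet_of_tendsto hg
        (U := (hyperfilter ℕ).map fun n => α (initialWord ξ n)) (z := x₀) ?_ ?_
      · exact (α.injective.tendsto_cofinite.comp (tendsto_initialWord hξ)).mono_left
          Nat.hyperfilter_le_atTop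
      · rw [Ultrafilter.coe_map, tendsto_map'_iff]
        simpa only [Function.comp_def, ← hρ] using hx
    · obtain ⟨x', hx'⟩ := hcpt U
      rw [h.eq_of_mem_nest_initialList hg hη
        (h.lim_mem_nest hg hρ hx₀ Nat.hyperfilter_le_atTop hξ hξη hx)
        (h.lim_mem_nest hg hρ hx₀ hU hξ hξη hx')]
      exact hx'
  refine ⟨hlim, ?_, ?_, ?_⟩
  · intro ξ ξ' hξ hξ' x hx hx'
    obtain ⟨η, hη, hξη⟩ := exists_map_infiniteWord hα hξ
    obtain ⟨η', hη', hξη'⟩ := exists_map_infiniteWord hα hξ'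
    have hηη' : ∀ N, initialList η N = initialList η' N := fun N =>
      h.eq_of_mem_nest (by simp only [length_initialList]) (hmem hξ hξη hx N)
        (hmem hξ' hξη' hx' N)
    -- The images of the two words under `α` have the same prefixes; uniform continuity of `α⁻¹`
    -- carries this back to the words themselves.
    funext i
    obtain ⟨k, hk⟩ := exists_wordPrefix_map_eq hα' (i + 1)
    obtain ⟨n, ⟨h1, h2⟩, h3⟩ := (((hξη k).and (hξη' k)).and (eventually_ge_atTop (i + 1))).exists
    have h4 := hk _ _ (length_le_of_wordPrefix_eq h1) (length_le_of_wordPrefix_eq h2)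
      (by rw [h1, h2, hηη' k])
    simp only [MonoidHom.coe_coe, MulEquiv.symm_apply_apply] at h4
    rw [wordPrefix_initialWord hξ h3, wordPrefix_initialWord hξ' h3, initialList_eq_iff] at h4
    exact h4 i (Nat.lt_succ_self i)
  · intro x hx
    obtain ⟨U, hU, hUx⟩ := h.exists_ultrafilter_tendsto hg hx₀ (hrange ▸ hx)
    obtain ⟨η', hη', hUη'⟩ := exists_infiniteWord_of_ultrafilter hU
    -- The word for the marking `ρ` is the limit of the ultrafilter pulled back by `α`; its image
    -- under `α` must then be `η'`.
    obtain ⟨ξ, hξ, hUξ⟩ := exists_infiniteWord_of_ultrafilter (U := U.map α.symm)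
      (hα'.tendsto_cofinite.mono_left hU)
    obtain ⟨y, -, hy⟩ := hlim ξ hξ
    obtain ⟨η, hη, hξη⟩ := exists_map_infiniteWord hα hξ
    have hηη' : ∀ N, initialList η N = initialList η' N := by
      intro N
      obtain ⟨k, hk⟩ := exists_wordPrefix_map_eq hα N
      have hUξ' : ∀ᶠ u in (U : Filter (FreeGroup (Fin g))),
        wordPrefix k (α.symm u) = initialList ξ k := hUξ k
      obtain ⟨u, h1, h2⟩ := ((hUη' N).and hUξ').exists
      obtain ⟨n, h3, h4⟩ := ((hξη N).and (eventually_ge_atTop k)).exists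
      have h5 := hk _ _ (length_le_of_wordPrefix_eq h2)
        (by rwa [norm_initialWord hξ] : k ≤ (initialWord ξ n).norm)
        (by rw [h2, wordPrefix_initialWord hξ h4])
      simp only [MonoidHom.coe_coe, MulEquiv.apply_symm_apply] at h5
      rw [← h3, ← h1, h5]
      rfl
    refine ⟨ξ, hξ, ?_⟩
    rwa [h.eq_of_mem_nest_initialList hg hη (x := x) (x' := y) (fun N => ?_) (hmem hξ hξη hy)]
    rw [hηη']
    exact h.tendsto_lim_mem_nest hg hU hUη' hx₀ hUx N
  · intro ξ x hξ hx O hO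
    obtain ⟨η, hη, hξη⟩ := exists_map_infiniteWord hα hξ
    -- The decreasing compact sets of the nest intersect only in `x`, so one of them is contained in
    -- the neighbourhood.
    obtain ⟨N, hN⟩ : ∃ N, nest σ D (initialList η N) ⊆ O := by
      refine exists_subset_nhds_of_isCompact (V := fun N => nest σ D (initialList η N))
        (directed_of_isDirected_le fun m n hmn => ?_)
        (fun N => (h.isClosed_nest _).isCompact) fun y hy => ?_
      · intro y hy
        rw [← take_initialList η hmn]
        rw [← List.take_append_drop m (initialList η n)] at hy
        exact nest_append_subset hy
      · rw [h.eq_of_mem_nest_initialList hg hη (Set.mem_iInter.1 hy) (hmem hξ hξη hx)]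
        exact hO
    obtain ⟨k, hk⟩ := exists_wordPrefix_map_eq hα N
    refine ⟨k, fun ζ y hζ hζξ hy => hN ?_⟩
    obtain ⟨θ, hθ, hζθ⟩ := exists_map_infiniteWord hα hζ
    have hθη : initialList θ N = initialList η N := by
      obtain ⟨n, ⟨h1, h2⟩, h3⟩ := (((hξη N).and (hζθ N)).and (eventually_ge_atTop k)).exists
      rw [← h1, ← h2]
      refine hk _ _ (by rwa [norm_initialWord hζ]) (by rwa [norm_initialWord hξ]) ?_
      rw [wordPrefix_initialWord hζ h3, wordPrefix_initialWord hξ h3]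
      exact initialList_eq_iff.2 hζξ
    rw [← hθη]
    exact hmem hζ hζθ hy N

/-- The limit set of a Schottky group is coded by infinite reduced words for every marking of the
group, not only for the one given by the discs. -/
theorem isBoundaryCoding_of_isSchottkyGroup {ρ : FreeGroup (Fin g) →* PGL(2, ℂ)} (hg : g ≠ 0)
    (hρ : Function.Injective ρ) (hΓ : IsSchottkyGroup g ρ.range) {x₀ : Sphere}
    (hx₀ : x₀ ∉ limitSet ρ.range) : IsBoundaryCoding ρ x₀ := by
  obtain ⟨σ, D, h, hrange⟩ := exists_isPingPong hΓ
  let e₁ := MonoidHom.ofInjective hρ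
  let e₂ := MonoidHom.ofInjective (h.injective hg)
  let α := (e₁.trans (MulEquiv.subgroupCongr hrange.symm)).trans e₂.symm
  refine h.isBoundaryCoding (α := α) hg (fun u => ?_) (hrange ▸ hx₀)
  have h1 : e₂ (α u) = MulEquiv.subgroupCongr hrange.symm (e₁ u) := e₂.apply_symm_apply _
  exact (congrArg Subtype.val h1).symm

end Coding

end Schottky

/-! ### The filtration as functions of finitely many letters. -/

namespace Schottky

section Boundary

variable {g : ℕ}

/-- The boundary of the free group: the space of infinite reduced words. -/
abbrev InfiniteWord (g : ℕ) : Type := {ξ : ℕ → Fin g × Bool // IsInfiniteReducedWord ξ}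

instance : CompactSpace (InfiniteWord g) := by
  refine isCompact_iff_compactSpace.1 ?_
  have : IsClosed {ξ : ℕ → Fin g × Bool | IsInfiniteReducedWord ξ} := by
    simp only [IsInfiniteReducedWord, Set.ofPred_forall]
    refine isClosed_iInter fun n => ?_
    have hcont : Continuous fun ξ : ℕ → Fin g × Bool => (ξ n, ξ (n + 1)) :=
      (continuous_apply n).prodMk (continuous_apply (n + 1))
    exact (isClosed_discrete {p : (Fin g × Bool) × (Fin g × Bool) |
      p.1.1 = p.2.1 → p.1.2 = p.2.2}).preimage hcont
  exact this.isCompact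

theorem isClopen_setOf_initial (n : ℕ) (S : Set (Fin n → Fin g × Bool)) :
    IsClopen {ξ : InfiniteWord g | (fun i : Fin n => ξ.1 i) ∈ S} :=
  (isClopen_discrete S).preimage
    (continuous_pi fun i => (continuous_apply (i : ℕ)).comp continuous_subtype_val)

theorem isClopen_setOf_initialWord_eq (n : ℕ) (w : FreeGroup (Fin g)) :
    IsClopen {ξ : InfiniteWord g | initialWord ξ.1 n = w} :=
  isClopen_setOf_initial n {l | FreeGroup.mk (List.ofFn l) = w}

theorem initialWord_eq_of_eq {ξ ξ' : ℕ → Fin g × Bool} {n : ℕ} (h : ∀ i < n, ξ i = ξ' i) :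
    initialWord ξ n = initialWord ξ' n :=
  congrArg FreeGroup.mk (initialList_eq_iff.2 h)

theorem eq_of_initialWord_eq {ξ ξ' : InfiniteWord g} {n : ℕ}
    (h : initialWord ξ.1 n = initialWord ξ'.1 n) : ∀ i < n, ξ.1 i = ξ'.1 i := by
  rw [← initialList_eq_iff, ← toWord_initialWord ξ.2, ← toWord_initialWord ξ'.2, h]

instance nonempty_infiniteWord [NeZero g] : Nonempty (InfiniteWord g) :=
  ⟨⟨fun _ => (0, true), fun _ _ => rfl⟩⟩

variable {ρ : FreeGroup (Fin g) →* PGL(2, ℂ)} {x₀ : Sphere}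

/-- A continuous bijection from a compact space to a Hausdorff space. -/
theorem IsBoundaryCoding.exists_homeomorph (hc : IsBoundaryCoding ρ x₀) :
    ∃ e : InfiniteWord g ≃ₜ limitSet ρ.range, ∀ ξ,
      Tendsto (fun n => ρ (initialWord ξ.1 n) • x₀) atTop (𝓝 (e ξ : Sphere)) := by
  choose f hf hlim using fun ξ : InfiniteWord g => hc.exists_lim ξ.1 ξ.2
  let π : InfiniteWord g → limitSet ρ.range := fun ξ => ⟨f ξ, hf ξ⟩
  have hbij : Function.Bijective π := by
    constructor
    · intro ξ ξ' h
      refine Subtype.ext (hc.injective _ _ ξ.2 ξ'.2 (f ξ) (hlim ξ) ?_)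
      have h1 : f ξ = f ξ' := congrArg Subtype.val h
      rw [h1]
      exact hlim ξ'
    · rintro ⟨x, hx⟩
      obtain ⟨ξ, hξ, hξx⟩ := hc.surjective x hx
      exact ⟨⟨ξ, hξ⟩, Subtype.ext (tendsto_nhds_unique (hlim ⟨ξ, hξ⟩) hξx)⟩
  have hcont : Continuous π := by
    refine Continuous.subtype_mk (continuous_iff_continuousAt.2 fun ξ O hO => ?_) _
    obtain ⟨k, hk⟩ := hc.continuous ξ.1 (f ξ) ξ.2 (hlim ξ) O hO
    have h1 : {ζ : InfiniteWord g | initialWord ζ.1 k = initialWord ξ.1 k} ∈ 𝓝 ξ :=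
      (isClopen_setOf_initialWord_eq k _).isOpen.mem_nhds rfl
    refine mem_map.2 ?_
    filter_upwards [h1] with ζ hζ
    exact hk ζ.1 (f ζ) ζ.2 (eq_of_initialWord_eq hζ) (hlim ζ)
  exact ⟨Continuous.homeoOfEquivCompactToT2 (f := Equiv.ofBijective π hbij) hcont, hlim⟩

/-- The homeomorphism from the boundary of the free group onto the limit set. -/
noncomputable def IsBoundaryCoding.homeomorph (hc : IsBoundaryCoding ρ x₀) :
    InfiniteWord g ≃ₜ limitSet ρ.range := hc.exists_homeomorph.choose

theorem IsBoundaryCoding.tendsto_homeomorph (hc : IsBoundaryCoding ρ x₀) (ξ : InfiniteWord g) :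
    Tendsto (fun n => ρ (initialWord ξ.1 n) • x₀) atTop (𝓝 (hc.homeomorph ξ : Sphere)) :=
  hc.exists_homeomorph.choose_spec ξ

theorem IsBoundaryCoding.homeomorph_mem_ends (hc : IsBoundaryCoding ρ x₀) {ξ : InfiniteWord g}
    {w : FreeGroup (Fin g)} : hc.homeomorph ξ ∈ ends ρ x₀ w ↔ initialWord ξ.1 w.norm = w := by
  constructor
  · rintro ⟨ξ', hξ', h1, h2⟩
    rwa [hc.injective ξ.1 ξ' ξ.2 hξ' _ (hc.tendsto_homeomorph ξ) h2]
  · exact fun h => ⟨ξ.1, ξ.2, h, hc.tendsto_homeomorph ξ⟩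

theorem IsBoundaryCoding.isClopen_ends (hc : IsBoundaryCoding ρ x₀) (w : FreeGroup (Fin g)) :
    IsClopen (ends ρ x₀ w) := by
  have h1 : ends ρ x₀ w =
      hc.homeomorph.symm ⁻¹' {ξ : InfiniteWord g | initialWord ξ.1 w.norm = w} := by
    ext x
    rw [Set.mem_preimage, Set.mem_ofPred_eq, ← hc.homeomorph_mem_ends,
      Homeomorph.apply_symm_apply]
  rw [h1]
  exact (isClopen_setOf_initialWord_eq _ w).preimage hc.homeomorph.symm.continuous

/-- The characteristic function of the set of ends of a word. -/
noncomputable def IsBoundaryCoding.charFn (hc : IsBoundaryCoding ρ x₀) (w : FreeGroup (Fin g)) :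
    C(limitSet ρ.range, ℂ) := LocallyConstant.charFn ℂ (hc.isClopen_ends w)

theorem IsBoundaryCoding.coe_charFn (hc : IsBoundaryCoding ρ x₀) (w : FreeGroup (Fin g)) :
    (hc.charFn w : limitSet ρ.range → ℂ) = (ends ρ x₀ w).indicator 1 :=
  LocallyConstant.coe_charFn ℂ (hc.isClopen_ends w)

theorem IsBoundaryCoding.charFn_mem (hc : IsBoundaryCoding ρ x₀) {w : FreeGroup (Fin g)} {n : ℕ}
    (hw : w.norm ≤ n) : hc.charFn w ∈ filtration ρ x₀ n :=
  Submodule.subset_span ⟨w, hw, hc.coe_charFn w⟩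

theorem IsBoundaryCoding.charFn_homeomorph (hc : IsBoundaryCoding ρ x₀) (w : FreeGroup (Fin g))
    (ξ : InfiniteWord g) :
    hc.charFn w (hc.homeomorph ξ) = if initialWord ξ.1 w.norm = w then 1 else 0 := by
  rw [hc.coe_charFn]
  split_ifs with h
  · exact Set.indicator_of_mem (hc.homeomorph_mem_ends.2 h) 1
  · exact Set.indicator_of_notMem (fun h' => h (hc.homeomorph_mem_ends.1 h')) 1

/-- `A_n` consists of the functions that only depend on the first `n` letters. -/
theorem IsBoundaryCoding.mem_filtration_iff (hc : IsBoundaryCoding ρ x₀) {n : ℕ}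
    {f : C(limitSet ρ.range, ℂ)} : f ∈ filtration ρ x₀ n ↔
      ∀ ξ ξ' : InfiniteWord g, (∀ i < n, ξ.1 i = ξ'.1 i) →
        f (hc.homeomorph ξ) = f (hc.homeomorph ξ') := by
  classical
  constructor
  · intro hf ξ ξ' h
    induction hf using Submodule.span_induction with
    | mem f hf =>
      obtain ⟨w, hw, hfw⟩ := hf
      have h1 : f = hc.charFn w := DFunLike.coe_injective (hfw.trans (hc.coe_charFn w).symm)
      rw [h1, hc.charFn_homeomorph, hc.charFn_homeomorph,
        initialWord_eq_of_eq fun i hi => h i (hi.trans_le hw)]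
    | zero => rfl
    | add f f' _ _ hf hf' => simp [hf, hf']
    | smul c f _ hf => simp [hf]
  · intro hf
    have hfin : {w : FreeGroup (Fin g) | w.norm = n}.Finite :=
      (finite_norm_lt (n + 1)).subset fun w hw => by
        have : w.norm = n := hw
        change w.norm < n + 1
        omega
    -- The constant value of `f` on the cylinder of `w`; the default 0 is for words whose cylinder
    -- is empty.
    let c : FreeGroup (Fin g) → ℂ := fun w =>
      if h : ∃ ξ : InfiniteWord g, initialWord ξ.1 n = w then f (hc.homeomorph h.choose) else 0
    have hsum : f = ∑ w ∈ hfin.toFinset, c w • hc.charFn w := by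
      ext x
      obtain ⟨ξ, rfl⟩ := hc.homeomorph.surjective x
      have h1 : ∃ ζ : InfiniteWord g, initialWord ζ.1 n = initialWord ξ.1 n := ⟨ξ, rfl⟩
      rw [ContinuousMap.coe_sum, Finset.sum_apply, Finset.sum_eq_single (initialWord ξ.1 n)]
      · rw [ContinuousMap.smul_apply, hc.charFn_homeomorph, norm_initialWord ξ.2, if_pos rfl,
          smul_eq_mul, mul_one]
        simp only [c]
        rw [dif_pos h1]
        exact hf _ _ (eq_of_initialWord_eq h1.choose_spec.symm)
      · intro w hw hne
        have hw' : w.norm = n := by simpa using hw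
        rw [ContinuousMap.smul_apply, hc.charFn_homeomorph, hw', if_neg hne.symm, smul_zero]
      · intro h
        exact absurd (norm_initialWord ξ.2 n) (by simpa using h)
    rw [hsum]
    refine Submodule.sum_mem _ fun w hw => Submodule.smul_mem _ _ (hc.charFn_mem ?_)
    exact le_of_eq (by simpa using hw)

theorem IsBoundaryCoding.mul_mem_filtration (hc : IsBoundaryCoding ρ x₀) {m n : ℕ} (hmn : m ≤ n)
    {f h : C(limitSet ρ.range, ℂ)} (hf : f ∈ filtration ρ x₀ m) (hh : h ∈ filtration ρ x₀ n) :
    f * h ∈ filtration ρ x₀ n := by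
  rw [hc.mem_filtration_iff] at hf hh ⊢
  intro ξ ξ' hξ
  rw [ContinuousMap.mul_apply, ContinuousMap.mul_apply, hh ξ ξ' hξ,
    hf ξ ξ' fun i hi => hξ i (hi.trans_le hmn)]

theorem IsBoundaryCoding.star_mem_filtration (hc : IsBoundaryCoding ρ x₀) {n : ℕ}
    {f : C(limitSet ρ.range, ℂ)} (hf : f ∈ filtration ρ x₀ n) : star f ∈ filtration ρ x₀ n := by
  rw [hc.mem_filtration_iff] at hf ⊢
  intro ξ ξ' hξ
  rw [ContinuousMap.star_apply, ContinuousMap.star_apply, hf ξ ξ' hξ]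

theorem filtration_mono : Monotone (filtration ρ x₀) := fun _ _ hmn =>
  Submodule.span_mono fun _ ⟨w, hw, hf⟩ => ⟨w, hw.trans hmn, hf⟩

/-- Otherwise, for each `n`, two words agreeing in `n` letters would have different values; by
compactness both families have a common limit, near which `f` is constant. -/
theorem IsBoundaryCoding.exists_mem_filtration (hc : IsBoundaryCoding ρ x₀)
    {f : C(limitSet ρ.range, ℂ)} (hf : IsLocallyConstant f) : ∃ n, f ∈ filtration ρ x₀ n := by
  by_contra! hcon
  simp only [hc.mem_filtration_iff, not_forall] at hcon
  choose ξ ξ' hξ hne using hcon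
  obtain ⟨ζ, -, hζ⟩ := isCompact_univ.ultrafilter_le_nhds ((hyperfilter ℕ).map ξ) (by simp)
  have h1 : Tendsto ξ (hyperfilter ℕ) (𝓝 ζ) := hζ
  have h2 : Tendsto ξ' (hyperfilter ℕ) (𝓝 ζ) := by
    rw [tendsto_subtype_rng, tendsto_pi_nhds] at h1 ⊢
    intro i
    refine (h1 i).congr' ?_
    filter_upwards [Nat.hyperfilter_le_atTop (eventually_gt_atTop i)] with n hn
    exact hξ n i hn
  have h3 : ∀ᶠ θ in 𝓝 ζ, f (hc.homeomorph θ) = f (hc.homeomorph ζ) :=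
    (hf.comp_continuous hc.homeomorph.continuous).eventually_eq ζ
  obtain ⟨n, h4, h5⟩ := ((h1.eventually h3).and (h2.eventually h3)).exists
  exact hne n (h4.trans h5.symm)

theorem IsBoundaryCoding.locallyConstant_eq_iSup (hc : IsBoundaryCoding ρ x₀) :
    Subalgebra.toSubmodule (locallyConstant (limitSet ρ.range)).toSubalgebra =
      ⨆ n, filtration ρ x₀ n := by
  refine le_antisymm (fun f hf => ?_) (iSup_le fun n => Submodule.span_le.2 ?_)
  · obtain ⟨n, hn⟩ := hc.exists_mem_filtration hf
    exact Submodule.mem_iSup_of_mem n hn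
  · rintro f ⟨w, -, hf⟩
    have h1 : f = hc.charFn w := DFunLike.coe_injective (hf.trans (hc.coe_charFn w).symm)
    rw [h1]
    exact (LocallyConstant.charFn ℂ (hc.isClopen_ends w)).isLocallyConstant

/-- Two infinite words can agree in exactly their first `n` letters; a cylinder of length `n + 1`
separates them. -/
theorem IsBoundaryCoding.filtration_lt_succ (hc : IsBoundaryCoding ρ x₀) (hg : 2 ≤ g) (n : ℕ) :
    filtration ρ x₀ n < filtration ρ x₀ (n + 1) := by
  have : NeZero g := ⟨by omega⟩
  obtain ⟨ξ⟩ := nonempty_infiniteWord (g := g)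
  obtain ⟨ξ', hξ', h1, h2⟩ := exists_infiniteWord_ne hg ξ.2 n
  refine lt_of_le_of_ne (filtration_mono n.le_succ) fun heq => ?_
  have h3 : hc.charFn (initialWord ξ.1 (n + 1)) ∈ filtration ρ x₀ n :=
    heq ▸ hc.charFn_mem (norm_initialWord ξ.2 _).le
  have h4 := hc.mem_filtration_iff.1 h3 ⟨ξ', hξ'⟩ ξ h1
  rw [hc.charFn_homeomorph, hc.charFn_homeomorph, norm_initialWord ξ.2, if_pos rfl,
    if_neg fun h => h2 (eq_of_initialWord_eq (ξ := ⟨ξ', hξ'⟩) h n n.lt_succ_self)] at h4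
  exact zero_ne_one h4

theorem IsBoundaryCoding.succ_le_finrank (hc : IsBoundaryCoding ρ x₀) (hg : 2 ≤ g) (n : ℕ) :
    n + 1 ≤ Module.finrank ℂ (filtration ρ x₀ n) := by
  induction n with
  | zero =>
    have : NeZero g := ⟨by omega⟩
    obtain ⟨ξ⟩ := nonempty_infiniteWord (g := g)
    refine Module.finrank_pos_iff_exists_ne_zero.2
      ⟨⟨1, hc.mem_filtration_iff.2 fun _ _ _ => rfl⟩, fun h => ?_⟩
    have h1 : (1 : C(limitSet ρ.range, ℂ)) = 0 := congrArg Subtype.val h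
    exact one_ne_zero (DFunLike.congr_fun h1 (hc.homeomorph ξ))
  | succ n ih =>
    exact Nat.succ_le_of_lt
      (ih.trans_lt (Submodule.finrank_lt_finrank_of_lt (hc.filtration_lt_succ hg n)))

theorem IsBoundaryCoding.dense_locallyConstant (hc : IsBoundaryCoding ρ x₀) :
    Dense (locallyConstant (limitSet ρ.range) : Set C(limitSet ρ.range, ℂ)) := by
  have hsep : (locallyConstant (limitSet ρ.range)).SeparatesPoints := by
    intro x y hxy
    obtain ⟨ξ, rfl⟩ := hc.homeomorph.surjective x
    obtain ⟨ξ', rfl⟩ := hc.homeomorph.surjective y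
    have hne : ξ.1 ≠ ξ'.1 := fun h => hxy (by rw [Subtype.ext h])
    obtain ⟨i, hi⟩ := Function.ne_iff.1 hne
    refine ⟨hc.charFn (initialWord ξ.1 (i + 1)), ⟨hc.charFn (initialWord ξ.1 (i + 1)),
      (LocallyConstant.charFn ℂ (hc.isClopen_ends _)).isLocallyConstant, rfl⟩, ?_⟩
    rw [hc.charFn_homeomorph, hc.charFn_homeomorph, norm_initialWord ξ.2, if_pos rfl,
      if_neg fun h => hi (eq_of_initialWord_eq h i i.lt_succ_self).symm]
    exact one_ne_zero
  intro f
  have := ContinuousMap.starSubalgebra_topologicalClosure_eq_top_of_separatesPoints _ hsep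
  have h2 : f ∈ (locallyConstant (limitSet ρ.range)).topologicalClosure := this ▸ trivial
  exact h2

end Boundary

/-! ### The GNS space and the spectral triple. -/

section Triple

open scoped ComplexOrder

variable {g : ℕ} {ρ : FreeGroup (Fin g) →* PGL(2, ℂ)} {x₀ : Sphere}
  (μ : Measure (limitSet ρ.range)) [IsProbabilityMeasure μ]

theorem rep_toHilbertSpace (a b : C(limitSet ρ.range, ℂ)) :
    rep μ a (toHilbertSpace μ b) = toHilbertSpace μ (a * b) :=
  (state μ).gnsNonUnitalStarAlgHom_apply_coe

/-- The canonical map is the orbit map of the cyclic vector, and the representation is contractive.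
Continuity lets uniform density of the locally constant functions pass to `H`. -/
theorem continuous_toHilbertSpace : Continuous (toHilbertSpace μ) := by
  have h1 : ∀ a, toHilbertSpace μ a = rep μ a (toHilbertSpace μ 1) := fun a => by
    rw [rep_toHilbertSpace, mul_one]
  have h2 : Continuous (rep μ) :=
    AddMonoidHomClass.continuous_of_bound (rep μ) 1 fun a => by
      rw [one_mul]
      exact NonUnitalStarAlgHom.norm_apply_le (rep μ) a
  rw [funext h1]
  exact h2.clm_apply continuous_const

theorem denseRange_toHilbertSpace : DenseRange (toHilbertSpace μ) :=
  (UniformSpace.Completion.denseRange_coe (α := (state μ).PreGNS)).comp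
    (state μ).toPreGNS.surjective.denseRange (UniformSpace.Completion.continuous_coe _)

theorem gradedProj_eq_projDiff :
    gradedProj ρ x₀ μ = projDiff (hilbertFiltration ρ x₀ μ) := by
  funext n
  cases n <;> rfl

theorem dirac_eq_diagonal :
    dirac ρ x₀ μ = diagonal (projDiff (hilbertFiltration ρ x₀ μ)) (diracEigenvalue ρ x₀) := by
  rw [← gradedProj_eq_projDiff]
  rfl

theorem hilbertFiltration_mono : Monotone (hilbertFiltration ρ x₀ μ) := fun _ _ h =>
  Submodule.map_mono (filtration_mono h)

theorem IsBoundaryCoding.isOrthogonalGrading (hc : IsBoundaryCoding ρ x₀) :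
    IsOrthogonalGrading (projDiff (hilbertFiltration ρ x₀ μ)) := by
  refine isOrthogonalGrading_projDiff (hilbertFiltration_mono μ) ?_
  have h1 : (⨆ n, hilbertFiltration ρ x₀ μ n) =
      (⨆ n, filtration ρ x₀ n).map (toHilbertSpace μ) := by
    rw [Submodule.map_iSup]
    rfl
  rw [h1, ← hc.locallyConstant_eq_iSup, Submodule.map_coe]
  exact (denseRange_toHilbertSpace μ).dense_image (continuous_toHilbertSpace μ)
    hc.dense_locallyConstant

theorem rep_inner_left (a : C(limitSet ρ.range, ℂ)) (x y : HilbertSpace μ) :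
    ⟪rep μ a x, y⟫_ℂ = ⟪x, rep μ (star a) y⟫_ℂ := by
  rw [map_star, ContinuousLinearMap.star_eq_adjoint, ContinuousLinearMap.adjoint_inner_right]

theorem IsBoundaryCoding.rep_mem_hilbertFiltration (hc : IsBoundaryCoding ρ x₀) {m n : ℕ}
    (hmn : m ≤ n) {a : C(limitSet ρ.range, ℂ)} (ha : a ∈ filtration ρ x₀ m) (x : HilbertSpace μ)
    (hx : x ∈ hilbertFiltration ρ x₀ μ n) : rep μ a x ∈ hilbertFiltration ρ x₀ μ n := by
  obtain ⟨b, hb, rfl⟩ := hx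
  rw [rep_toHilbertSpace]
  exact Submodule.mem_map_of_mem (hc.mul_mem_filtration hmn ha hb)

/-- The shift in `m + 1 ≤ n` ensures that `a` commutes with both projections, onto `H_n` and onto
`H_{n-1}`. -/
theorem IsBoundaryCoding.projDiff_rep (hc : IsBoundaryCoding ρ x₀) {m n : ℕ} (hmn : m + 1 ≤ n)
    {a : C(limitSet ρ.range, ℂ)} (ha : a ∈ filtration ρ x₀ m) (x : HilbertSpace μ) :
    projDiff (hilbertFiltration ρ x₀ μ) n (rep μ a x) =
      rep μ a (projDiff (hilbertFiltration ρ x₀ μ) n x) := by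
  have h1 : ∀ k, m ≤ k → (hilbertFiltration ρ x₀ μ k).starProjection (rep μ a x) =
      rep μ a ((hilbertFiltration ρ x₀ μ k).starProjection x) := fun k hk =>
    starProjection_comm (rep_inner_left μ a) (hc.rep_mem_hilbertFiltration μ hk ha)
      (hc.rep_mem_hilbertFiltration μ hk (hc.star_mem_filtration ha)) x
  obtain ⟨k, rfl⟩ : ∃ k, n = k + 1 := ⟨n - 1, by omega⟩
  simp only [projDiff, sub_apply, map_sub]
  rw [h1 (k + 1) (by omega), h1 k (by omega)]

theorem diracEigenvalue_eq_ofReal (n : ℕ) : diracEigenvalue ρ x₀ n =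
    (((Module.finrank ℂ (filtration ρ x₀ n) : ℝ) ^ 3 : ℝ) : ℂ) := by
  simp [diracEigenvalue]

theorem summable_inv_succ_sq (C : ℝ) : Summable fun n : ℕ => C * (((n : ℝ) + 1) ^ 2)⁻¹ := by
  have h1 : Summable fun n : ℕ => (((n + 1 : ℕ) : ℝ) ^ 2)⁻¹ :=
    (summable_nat_add_iff 1).2 (Real.summable_nat_pow_inv.2 one_lt_two)
  simpa using h1.mul_left C

theorem IsBoundaryCoding.summable_resolvent (hc : IsBoundaryCoding ρ x₀) (hg : 2 ≤ g) (z : ℂ) :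
    Summable fun n => ‖(diracEigenvalue ρ x₀ n - z)⁻¹‖ := by
  refine Summable.of_norm_bounded_eventually_nat (summable_inv_succ_sq 2) ?_
  -- For `n ≥ 2‖z‖` one has `(n + 1)³ - ‖z‖ ≥ (n + 1)² / 2`, whence the constant 2 in the majorant.
  obtain ⟨N, hN⟩ := exists_nat_ge (2 * ‖z‖)
  filter_upwards [eventually_ge_atTop N] with n hn
  have h1 : ((n : ℝ) + 1) ≤ Module.finrank ℂ (filtration ρ x₀ n) := by
    exact_mod_cast hc.succ_le_finrank hg n
  set d : ℝ := (Module.finrank ℂ (filtration ρ x₀ n) : ℝ) with hd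
  have h2 : ((n : ℝ) + 1) ^ 3 ≤ d ^ 3 := pow_le_pow_left₀ (by positivity) h1 3
  have h3 : (N : ℝ) ≤ n := by exact_mod_cast hn
  have h4 : d ^ 3 - ‖z‖ ≤ ‖diracEigenvalue ρ x₀ n - z‖ := by
    rw [diracEigenvalue_eq_ofReal]
    refine le_trans ?_ (norm_sub_norm_le _ _)
    rw [Complex.norm_real, Real.norm_of_nonneg (by positivity)]
  have h5 : ((n : ℝ) + 1) ^ 2 ≤ 2 * ‖diracEigenvalue ρ x₀ n - z‖ := by
    have hn0 : (0 : ℝ) ≤ n := n.cast_nonneg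
    nlinarith [mul_nonneg hn0 hn0, mul_nonneg hn0 (mul_nonneg hn0 hn0)]
  have h6 : 0 < ‖diracEigenvalue ρ x₀ n - z‖ := by
    have : (0 : ℝ) < ((n : ℝ) + 1) ^ 2 := by positivity
    linarith
  rw [norm_norm, norm_inv, ← div_eq_mul_inv, inv_eq_one_div, div_le_div_iff₀ h6 (by positivity)]
  linarith

theorem IsBoundaryCoding.isSpectralTriple (hc : IsBoundaryCoding ρ x₀) (hg : 2 ≤ g) :
    IsSpectralTriple (rep μ) (dirac ρ x₀ μ) (locallyConstant (limitSet ρ.range)) := by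
  have hQ := hc.isOrthogonalGrading μ
  have hreal : ∀ n, star (diracEigenvalue ρ x₀ n) = diracEigenvalue ρ x₀ n := fun n => by
    rw [diracEigenvalue_eq_ofReal]
    exact Complex.conj_ofReal _
  rw [dirac_eq_diagonal]
  refine ⟨hQ.isSelfAdjoint_diagonal hreal, hQ.hasCompactResolvent hreal fun z _ =>
    hc.summable_resolvent hg z, hc.dense_locallyConstant, fun a ha => ?_⟩
  obtain ⟨m, hm⟩ := hc.exists_mem_filtration ha
  exact hasBoundedCommutator_diagonal (m + 1) fun n hn x => hc.projDiff_rep μ hn hm x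

theorem IsBoundaryCoding.isOneSummable (hc : IsBoundaryCoding ρ x₀) (hg : 2 ≤ g) :
    IsOneSummable (dirac ρ x₀ μ) := by
  have hQ := hc.isOrthogonalGrading μ
  set d : ℕ → ℝ := fun n => (Module.finrank ℂ (filtration ρ x₀ n) : ℝ) with hd
  have hd1 : ∀ n : ℕ, (n : ℝ) + 1 ≤ d n := fun n => by
    simp only [hd]
    exact_mod_cast hc.succ_le_finrank hg n
  have hl : diracEigenvalue ρ x₀ = fun n => ((d n ^ 3 : ℝ) : ℂ) :=
    funext diracEigenvalue_eq_ofReal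
  set t : ℕ → ℝ := fun n => (√(1 + (d n ^ 3) ^ 2))⁻¹ with ht
  -- Here the cube in the eigenvalue counts: one factor `d n` is spent on the multiplicity, leaving
  -- the summable `(d n)⁻²`.
  have htd : ∀ n, t n * d n ≤ (((n : ℝ) + 1) ^ 2)⁻¹ := by
    intro n
    have hpos : (0 : ℝ) < n + 1 := by positivity
    have hdpos : 0 < d n := hpos.trans_le (hd1 n)
    have h1 : d n ^ 3 ≤ √(1 + (d n ^ 3) ^ 2) := Real.le_sqrt_of_sq_le (by linarith)
    calc t n * d n ≤ (d n ^ 3)⁻¹ * d n :=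
          mul_le_mul_of_nonneg_right (inv_anti₀ (by positivity) h1) hdpos.le
      _ = (d n ^ 2)⁻¹ := by field_simp
      _ ≤ _ := inv_anti₀ (by positivity) (pow_le_pow_left₀ hpos.le (hd1 n) 2)
  have ht0 : ∀ n, 0 ≤ t n := fun n => by positivity
  have hsum := summable_inv_succ_sq 1
  simp only [one_mul] at hsum
  have hs' : Summable fun n => t n * d n :=
    Summable.of_nonneg_of_le (fun n => mul_nonneg (ht0 n) (by positivity)) htd hsum
  have hs : Summable fun n => ‖(t n : ℂ)‖ := by
    refine Summable.of_nonneg_of_le (fun n => norm_nonneg _) (fun n => ?_) hs'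
    rw [Complex.norm_real, Real.norm_of_nonneg (ht0 n)]
    refine le_mul_of_one_le_right (ht0 n) ?_
    have := hd1 n
    have hn0 : (0 : ℝ) ≤ n := n.cast_nonneg
    linarith
  rw [dirac_eq_diagonal, hl]
  refine ⟨_, hQ.isInvSqrtOneAddSq hs, hQ.hasFiniteTrace_tsum (hilbertFiltration ρ x₀ μ)
    (projDiff_mem (hilbertFiltration_mono μ)) ht0 hs ?_⟩
  refine Summable.of_nonneg_of_le (fun n => mul_nonneg (ht0 n) (by positivity)) (fun n => ?_) hs'
  refine mul_le_mul_of_nonneg_left ?_ (ht0 n)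
  -- `A_n → H_n` need only be surjective: the dimension of `H_n` is bounded above by that of `A_n`,
  -- and the lower bound `n + 1` is used for `A_n` alone.
  exact Nat.cast_le.2 (Submodule.finrank_map_le (toHilbertSpace μ) (filtration ρ x₀ n))

end Triple

end Schottky

theorem propositionA (X : Type*) [TopologicalSpace X] [T2Space X] [CompactSpace X]
    [ConnectedSpace X] [ChartedSpace ℂ X] [IsManifold 𝓘(ℂ) ω X]
    (g : ℕ) (hg : 2 ≤ g) (hX : Schottky.HasGenus X g)
    (ρ : FreeGroup (Fin g) →* PGL(2, ℂ)) (hρ : Schottky.IsSchottkyUniformization X ρ)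
    (x₀ : OnePoint ℂ) (hx₀ : x₀ ∉ Schottky.limitSet ρ.range)
    (μ : Measure (Schottky.limitSet ρ.range)) [IsProbabilityMeasure μ]
    (hμ : Schottky.IsPattersonSullivan ρ.range μ) :
    (∀ w : FreeGroup (Fin g), IsClopen (Schottky.ends ρ x₀ w)) ∧
    Subalgebra.toSubmodule (Schottky.locallyConstant (Schottky.limitSet ρ.range)).toSubalgebra =
      ⨆ n, Schottky.filtration ρ x₀ n ∧
    Schottky.IsSpectralTriple (Schottky.rep μ) (Schottky.dirac ρ x₀ μ)
      (Schottky.locallyConstant (Schottky.limitSet ρ.range)) ∧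
    Schottky.IsOneSummable (Schottky.dirac ρ x₀ μ) := by
  have hc := Schottky.isBoundaryCoding_of_isSchottkyGroup (by omega) hρ.injective
    hρ.isSchottkyGroup hx₀
  exact ⟨hc.isClopen_ends, hc.locallyConstant_eq_iSup, hc.isSpectralTriple μ hg,
    hc.isOneSummable μ hg⟩
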